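/- Let $n\ge 3$ and $k\ge 0$ be integers. Index the standard basis of $\mathbb C^{k+1}$ and the rows and columns of $(k+1)\times(k+1)$ matrices by $0,\dots,k$. For $0\le l\le k$ let $|E_l\rangle=\sum_{i_1+\dots+i_n=l}|i_1i_2\dots i_n\rangle\in(\mathbb C^{k+1})^{\otimes n}$. The stabilizer of $|E_k\rangle$ is the group of all $(S^{(1)},\dots,S^{(n)})\in GL(k+1,\mathbb C)^{\times n}$ with $S^{(1)}\otimes\dots\otimes S^{(n)}|E_k\rangle=|E_k\rangle$. For $y=(y_1,\dots,y_k)\in\mathbb C^k$ let $\mathcal S(y)$ be the set of upper triangular matrices $\bar S$ with $\bar S_{l,l}=1$ for all $l$ that satisfy the recursion $$\bar S_{i+1,l}=\sum_{j=1}^{l-i}\bar S_{i,l-j}\,y_j\qquad(0\le i<k,\ 0\le l\le k)\qquad(\ast)$$ and $\langle E_l|\bar S^{\otimes n}|E_k\rangle=0$ for $0\le l<k$. Let $D_x=\operatorname{diag}(1,x,\dots,x^k)$. Then: 1. The stabilizer of $|E_k\rangle$ is generated by the following two kinds of symmetries: the operators $B_{(i)}\otimes B_{(j)}^{-1}$ ($B$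 acting on party $i$, $B^{-1}$ on party $j\ne i$, the identity elsewhere) with $B$ an arbitrary invertible upper triangular Toeplitz matrix; and the operators $A^{\otimes n}$ with $A=c\,D_x\bar S$, where $x\neq0$, $\bar S\in\mathcal S(y)$ for some $y$, and $c\in\mathbb C$ is a proportionality factor with $c^nx^k=1$. 2. For $i\ne j$ and an invertible matrix $B$, the operator $B_{(i)}\otimes B_{(j)}^{-1}$ is a symmetry of $|E_k\rangle$ if and only if $B$ is an upper triangular Toeplitz matrix. For an invertible matrix $A$ and $\mu\in\mathbb C$, one has $A^{\otimes n}|E_k\rangle=\mu|E_k\rangle$ if and only if $A=c\,D_x\bar S$ and $\mu=c^nx^k$ for some $c$, some $x\neq 0$, some $y$ and some $\bar S\in\mathcal S(y)$. 3. If $n\ge k-1$, the matrices $\bar S$ can be determined by successively solving linear equations: for a matrix $\bar S$ that is upper triangular with unit diagonal and satisfies $(\ast)$, the conditions $\langle E_l|\bar S^{\otimes n}|E_k\rangle=0$ $(0\le l<k)$ are equivalent to the equations $\langle 1^{k-l}0^{\,n-k+l}|\bar S^{\otimes n}|E_k\rangle=0$ for $l=1,\dots,k$, and the left-hand side of the $l$-th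 of these equations equals $n\,\bar S_{0,l}+Q_l(y,\bar S_{0,0},\dots,\bar S_{0,l-1})$ for a polynomial $Q_l$ that depends only on $n,k,l$. 4. If $k\ge1$, then $\mathcal S(y)=\emptyset$ unless $y_1=1$. For every $y$ (with $y_1=1$ if $k\ge1$), $\mathcal S(y)$ has exactly one element. Its entries are polynomials in $y$ that depend only on $n$ and $k$, and it determines $y$. The matrices $\bar S$ (for all $y$) form a group. 5. The matrices $D_x\bar S$ ($x\ne0$, $\bar S\in\mathcal S(y)$ for some $y$) form a $k$-parameter group: they form a group, $D_x\bar S$ satisfies the recursion $(\ast)$ with parameters $z=(xy_1,\dots,xy_k)$ in place of $y$, every element of the group satisfies $(\ast)$ for exactly one $z\in\mathbb C^k$, and every $z\in\mathbb C^k$ (with $z_1\neq0$ if $k\ge1$) arises from exactly one element of the group. In particular, except for a set of Lebesgue measure zero, any choice of $z\in\mathbb C^k$ leads to a solution. -/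

import Mathlib

open scoped Matrix

namespace EState

/-- The operator `S 0 ⊗ S 1 ⊗ ⋯ ⊗ S (n-1)` on `(ℂ^d)^{⊗ n}`, as a matrix in the computational basis
`|i_1 i_2 … i_n⟩`, which is indexed by the functions `Fin n → Fin d`. -/
def tensorOp {n d : ℕ} (S : Fin n → Matrix (Fin d) (Fin d) ℂ) :
    Matrix (Fin n → Fin d) (Fin n → Fin d) ℂ :=
  Matrix.of fun m i => ∏ j, S j (m j) (i j)

theorem tensorOp_mul {n d : ℕ} (S T : Fin n → Matrix (Fin d) (Fin d) ℂ) :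
    tensorOp (fun j => S j * T j) = tensorOp S * tensorOp T := by
  ext m i
  simp only [tensorOp, Matrix.of_apply, Matrix.mul_apply, ← Finset.prod_mul_distrib]
  rw [Finset.prod_univ_sum, Fintype.piFinset_univ]

theorem tensorOp_one {n d : ℕ} :
    tensorOp (fun _ : Fin n => (1 : Matrix (Fin d) (Fin d) ℂ)) = 1 := by
  ext m i
  simp only [tensorOp, Matrix.of_apply, Matrix.one_apply]
  by_cases h : m = i
  · simp [h]
  · rw [if_neg h]
    obtain ⟨j, hj⟩ := Function.ne_iff.mp h
    exact Finset.prod_eq_zero (Finset.mem_univ j) (if_neg hj)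

/-- The local stabilizer of a state `ψ ∈ (ℂ^d)^{⊗ n}`: the group of all
`(S^{(1)}, …, S^{(n)}) ∈ GL(d, ℂ)^{× n}` with `S^{(1)} ⊗ ⋯ ⊗ S^{(n)} ψ = ψ`. -/
def stabilizer {n d : ℕ} (ψ : (Fin n → Fin d) → ℂ) :
    Subgroup (Fin n → Matrix.GeneralLinearGroup (Fin d) ℂ) where
  carrier := {S | tensorOp (fun j => (S j : Matrix (Fin d) (Fin d) ℂ)) *ᵥ ψ = ψ}
  one_mem' := by
    have h := tensorOp_one (n := n) (d := d)
    simp [h]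
  mul_mem' := by
    intro S T hS hT
    simp only [Set.mem_ofPred_eq] at hS hT ⊢
    have h := tensorOp_mul (fun j => (S j : Matrix (Fin d) (Fin d) ℂ))
      (fun j => (T j : Matrix (Fin d) (Fin d) ℂ))
    simp only [Pi.mul_apply, Units.val_mul]
    rw [h, ← Matrix.mulVec_mulVec, hT, hS]
  inv_mem' := by
    intro S hS
    simp only [Set.mem_ofPred_eq] at hS ⊢
    have h := tensorOp_mul (fun j => ((S⁻¹) j : Matrix (Fin d) (Fin d) ℂ))
      (fun j => (S j : Matrix (Fin d) (Fin d) ℂ))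
    have h1 : (fun j => ((S⁻¹) j : Matrix (Fin d) (Fin d) ℂ) * (S j : Matrix (Fin d) (Fin d) ℂ))
        = fun _ => 1 := by
      funext j
      rw [Pi.inv_apply, ← Units.val_mul, inv_mul_cancel, Units.val_one]
    rw [h1, tensorOp_one] at h
    conv_lhs => rw [← hS]
    rw [Matrix.mulVec_mulVec, ← h, Matrix.one_mulVec]

/-- The (unnormalized) state `|E_l⟩ = ∑_{i_1 + ⋯ + i_n = l} |i_1 i_2 … i_n⟩` in
`(ℂ^{k+1})^{⊗ n}`. -/
def stateE (n k l : ℕ) : (Fin n → Fin (k + 1)) → ℂ :=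
  fun i => if ∑ j, (i j : ℕ) = l then 1 else 0

/-- The local operator `B_{(i)} ⊗ B_{(j)}^{-1}` (for `i ≠ j`): `B` acts on party `i`, `B⁻¹` acts on
party `j`, and the identity acts on all others. -/
def pairOp {n d : ℕ} (i j : Fin n) (B : Matrix.GeneralLinearGroup (Fin d) ℂ) :
    Fin n → Matrix.GeneralLinearGroup (Fin d) ℂ :=
  Pi.mulSingle i B * Pi.mulSingle j B⁻¹

/-- `B` is an upper triangular Toeplitz matrix. -/
def IsUpperToeplitz {d : ℕ} (B : Matrix (Fin d) (Fin d) ℂ) : Prop :=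
  ∃ b : ℕ → ℂ, ∀ i j : Fin d, B i j = if i ≤ j then b ((j : ℕ) - (i : ℕ)) else 0

/-- The diagonal matrix `diag(1, x, x², …, x^k)`. -/
def diagPow (k : ℕ) (x : ℂ) : Matrix (Fin (k + 1)) (Fin (k + 1)) ℂ :=
  Matrix.diagonal fun l => x ^ (l : ℕ)

/-- The recursion `S_{i+1,l} = ∑_{j=1}^{l-i} S_{i,l-j} y_j` for `0 ≤ i < k`, `0 ≤ l ≤ k`.
The parameters `y_1, …, y_k` are stored as `y 0, …, y (k-1)`, so that the summation index `j` below
stands for `j + 1`; the sum is empty when `l ≤ i`. -/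
def Recursion {k : ℕ} (y : Fin k → ℂ) (S : Matrix (Fin (k + 1)) (Fin (k + 1)) ℂ) : Prop :=
  ∀ (i : Fin k) (l : Fin (k + 1)),
    S i.succ l = ∑ j : Fin k, if (i : ℕ) + ((j : ℕ) + 1) ≤ (l : ℕ)
      then S i.castSucc ⟨(l : ℕ) - ((j : ℕ) + 1), by omega⟩ * y j else 0

/-- Upper triangular with all diagonal entries equal to `1`. -/
def IsUnitUpper {d : ℕ} (S : Matrix (Fin d) (Fin d) ℂ) : Prop :=
  S.BlockTriangular id ∧ ∀ l, S l l = 1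

/-- `⟨E_l| S^{⊗ n} |E_k⟩ = 0` for all `0 ≤ l < k`. -/
def OverlapsVanish (n : ℕ) {k : ℕ} (S : Matrix (Fin (k + 1)) (Fin (k + 1)) ℂ) : Prop :=
  ∀ l < k, star (stateE n k l) ⬝ᵥ (tensorOp (fun _ : Fin n => S) *ᵥ stateE n k k) = 0

/-- `S` is one of the matrices `S̄`, with parameters `y_1, …, y_k`. -/
def IsSbar (n : ℕ) {k : ℕ} (y : Fin k → ℂ) (S : Matrix (Fin (k + 1)) (Fin (k + 1)) ℂ) : Prop :=
  IsUnitUpper S ∧ Recursion y S ∧ OverlapsVanish n S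

/-- The label of the computational basis state in which the first `t` parties are in `|1⟩` and all
others in `|0⟩`. -/
def onesState (n k t : ℕ) : Fin n → Fin (k + 1) :=
  fun j => if (j : ℕ) < t then 1 else 0

/-- The symmetries of the first kind, `B_{(i)} ⊗ B_{(j)}^{-1}` with `i ≠ j` and `B` any invertible
upper triangular Toeplitz matrix. -/
def pairGenerators (n k : ℕ) : Set (Fin n → Matrix.GeneralLinearGroup (Fin (k + 1)) ℂ) :=
  {g | ∃ i j : Fin n, i ≠ j ∧ ∃ B : Matrix.GeneralLinearGroup (Fin (k + 1)) ℂ,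
    IsUpperToeplitz (B : Matrix (Fin (k + 1)) (Fin (k + 1)) ℂ) ∧ g = pairOp i j B}

/-- The symmetries of the second kind, `A^{⊗ n}` with `A = c D S̄`, where the proportionality factor
`c` is such that the eigenvalue `c^n x^k` of `A^{⊗ n}` at `|E_k⟩` is `1`. -/
def powerGenerators (n k : ℕ) : Set (Fin n → Matrix.GeneralLinearGroup (Fin (k + 1)) ℂ) :=
  {g | ∃ (A : Matrix.GeneralLinearGroup (Fin (k + 1)) ℂ) (c x : ℂ) (y : Fin k → ℂ)
      (S : Matrix (Fin (k + 1)) (Fin (k + 1)) ℂ),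
    x ≠ 0 ∧ IsSbar n y S ∧ c ^ n * x ^ k = 1 ∧
      (A : Matrix (Fin (k + 1)) (Fin (k + 1)) ℂ) = c • (diagPow k x * S) ∧ g = fun _ => A}

end EState

/-! Read a row vector of length k + 1 as a class in R = ℂ[X]/(X^(k+1)). Then |E_k⟩ is the n-linear
form sending (f_1, …, f_n) to φ(f_1⋯f_n), where φ takes the coefficient of X^k. This φ is
nondegenerate: if φ(a r) = φ(b r) for all r, then a = b. Suppose invertible S_j preserve the form up
to a scalar μ. As n ≥ 3, a spare factor is free to test equality in R, and every S_j turns out to be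
a unit u_j times one common multiplicative map σ (`exists_monoidHom_of_preserves_prod`). So row m of
S_j is u_j z^m with z = σ(X), where z(0) = 0 and z'(0) ≠ 0 (`exists_substMatrix_of_mulVec_eq_smul`).
The eigenvector equation then says that coefficient k of (∏ u_j) z^l is μ for l = k and 0 for l < k
(`tensorOp_substMatrix_eq_smul_iff`).

In these terms Toeplitz matrices are the case z = X, and (∗) says that z = y_1 X + ⋯ + y_k X^k. For
S̄ the unit diagonal means u(0) = 1 and y_1 = 1, and the overlap conditions say that coefficient k
of u^n z^l vanishes for l < k. This system is triangular: coefficient m of u enters the equation l =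
k - m linearly with factor n, and is absent for larger l. Hence u exists and is unique modulo
X^(k+1) (`exists_weight`, `jet_weight_unique`); solving over a polynomial ring makes it polynomial
in y.

For a general stabilizer element, write z = x y(X) and take the symmetry A^{⊗ n} with the same z and
weight c w. Nondegeneracy gives ∏ u_j = (c w)^n in R, so u_j = c w v_j with ∏ v_j = 1 in R: what
remains are Toeplitz factors with product one, and these are products of operators B ⊗ B⁻¹. -/

namespace EState

open PowerSeries

/-! ### Weighted substitutions modulo X^(k+1) -/

section Jet

variable {A : Type*} [CommRing A] {k : ℕ}

/-- Truncation of power series modulo `X ^ (k + 1)`. -/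
noncomputable abbrev jet (A : Type*) [CommRing A] (k : ℕ) :
    A⟦X⟧ →+* A⟦X⟧ ⧸ Ideal.span {(X : A⟦X⟧) ^ (k + 1)} :=
  Ideal.Quotient.mk _

theorem jet_eq_iff {a b : A⟦X⟧} :
    jet A k a = jet A k b ↔ ∀ i ≤ k, coeff i a = coeff i b := by
  rw [Ideal.Quotient.eq, Ideal.mem_span_singleton, X_pow_dvd_iff]
  simp [sub_eq_zero]

theorem coeff_eq_of_jet_eq {a b : A⟦X⟧} (h : jet A k a = jet A k b) {i : ℕ} (hi : i ≤ k) :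
    coeff i a = coeff i b :=
  jet_eq_iff.1 h i hi

/-- The matrix, in the basis `1, X, …, X ^ k` and acting on row vectors, of the weighted
substitution `f ↦ u * f(z)` of power series modulo `X ^ (k + 1)`. -/
noncomputable def substMatrix (k : ℕ) (u z : A⟦X⟧) : Matrix (Fin (k + 1)) (Fin (k + 1)) A :=
  Matrix.of fun m l => coeff (l : ℕ) (u * z ^ (m : ℕ))

theorem substMatrix_apply (u z : A⟦X⟧) (m l : Fin (k + 1)) :
    substMatrix k u z m l = coeff (l : ℕ) (u * z ^ (m : ℕ)) :=
  rfl

theorem substMatrix_congr {u u' z z' : A⟦X⟧} (hu : jet A k u = jet A k u')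
    (hz : jet A k z = jet A k z') : substMatrix k u z = substMatrix k u' z' := by
  ext m l
  exact coeff_eq_of_jet_eq (a := u * z ^ (m : ℕ)) (b := u' * z' ^ (m : ℕ))
    (by rw [map_mul, map_mul, map_pow, map_pow, hu, hz]) (Nat.lt_succ_iff.1 l.2)

theorem jet_eq_of_substMatrix_eq {u u' z z' : A⟦X⟧}
    (h : substMatrix k u z = substMatrix k u' z') : jet A k u = jet A k u' := by
  rw [jet_eq_iff]
  intro i hi
  simpa [substMatrix_apply] using congrFun₂ h 0 ⟨i, Nat.lt_succ_iff.2 hi⟩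

/-- Row 1 is u * z and row 0 is the unit u, so z is their quotient. For k = 0 there is no row 1, but
then only the constant coefficient matters. -/
theorem jet_eq_of_substMatrix_eq' {u u' z z' : A⟦X⟧}
    (h : substMatrix k u z = substMatrix k u' z') (hu : IsUnit (constantCoeff u))
    (hz : constantCoeff z = 0) (hz' : constantCoeff z' = 0) : jet A k z = jet A k z' := by
  rcases Nat.eq_zero_or_pos k with rfl | hk
  · rw [jet_eq_iff]
    intro i hi
    obtain rfl : i = 0 := by omega
    simp [hz, hz']
  · have h1 : jet A k (u * z) = jet A k (u' * z') := by
      rw [jet_eq_iff]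
      intro i hi
      simpa [substMatrix_apply] using
        congrFun₂ h ⟨1, by omega⟩ ⟨i, Nat.lt_succ_iff.2 hi⟩
    rw [map_mul, map_mul, ← jet_eq_of_substMatrix_eq h] at h1
    exact ((isUnit_iff_constantCoeff.2 hu).map (jet A k)).mul_left_cancel h1

theorem coeff_mul_pow_eq_zero {z : A⟦X⟧} (hz : constantCoeff z = 0) (a : A⟦X⟧) {i l m : ℕ}
    (h : m < i + l) : coeff m (X ^ i * a * z ^ l) = 0 := by
  obtain ⟨w, rfl⟩ := X_dvd_iff.2 hz
  have : (X : A⟦X⟧) ^ (i + l) ∣ X ^ i * a * (X * w) ^ l := ⟨a * w ^ l, by ring⟩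
  exact X_pow_dvd_iff.1 this m h

/-- The lowest possible term of a product of order at least i + l; every triangularity argument
below reads it off. -/
theorem coeff_mul_pow_eq {z : A⟦X⟧} (hz : constantCoeff z = 0) (a : A⟦X⟧) (i l : ℕ) :
    coeff (i + l) (X ^ i * a * z ^ l) = constantCoeff a * coeff 1 z ^ l := by
  obtain ⟨w, rfl⟩ := X_dvd_iff.2 hz
  have h : X ^ i * a * (X * w) ^ l = X ^ (i + l) * (a * w ^ l) := by ring
  have h1 : coeff 1 (X * w) = constantCoeff w := by
    simp
  rw [h, h1]
  have := coeff_X_pow_mul (a * w ^ l) (i + l) 0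
  simpa using this

theorem substMatrix_blockTriangular {u z : A⟦X⟧} (hz : constantCoeff z = 0) :
    (substMatrix k u z).BlockTriangular id := by
  intro i j hij
  have := coeff_mul_pow_eq_zero hz u (i := 0) (l := (i : ℕ)) (m := (j : ℕ)) (by simpa using hij)
  rwa [pow_zero, one_mul] at this

theorem substMatrix_diag {u z : A⟦X⟧} (hz : constantCoeff z = 0) (l : Fin (k + 1)) :
    substMatrix k u z l l = constantCoeff u * coeff 1 z ^ (l : ℕ) := by
  have := coeff_mul_pow_eq hz u 0 (l : ℕ)
  rwa [pow_zero, one_mul, zero_add] at this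

theorem smul_substMatrix (c : A) (u z : A⟦X⟧) :
    c • substMatrix k u z = substMatrix k (c • u) z := by
  ext m l
  simp [substMatrix_apply]

theorem substMatrix_one_X : substMatrix k (1 : A⟦X⟧) X = 1 := by
  ext m l
  simp [substMatrix_apply, coeff_X_pow, Matrix.one_apply, Fin.ext_iff, eq_comm]

/-- Matrices act on row vectors, so the right factor acts last: a Toeplitz factor on the right
changes the weight and leaves z alone. -/
theorem substMatrix_mul_X (u z v : A⟦X⟧) :
    substMatrix k u z * substMatrix k v X = substMatrix k (u * v) z := by
  ext m l
  have h : u * v * z ^ (m : ℕ) = u * z ^ (m : ℕ) * v := by ring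
  simp only [Matrix.mul_apply, substMatrix_apply, h, coeff_mul_X_pow']
  rw [coeff_mul, Finset.Nat.sum_antidiagonal_eq_sum_range_succ
      (fun i j => coeff i (u * z ^ (m : ℕ)) * coeff j v),
    Fin.sum_univ_eq_sum_range
      (fun j => coeff j (u * z ^ (m : ℕ)) * if j ≤ (l : ℕ) then coeff (l - j) v else 0)]
  simp only [mul_ite, mul_zero]
  rw [← Finset.sum_filter]
  refine Finset.sum_congr ?_ fun _ _ => rfl
  ext j
  simp only [Finset.mem_filter, Finset.mem_range]
  omega

/-- Nondegeneracy of the top coefficient. If a - b = X^m d with m ≤ k, testing against z^(k-m) reads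
off d(0) times a unit, so d(0) = 0 and the order rises. -/
theorem jet_eq_of_coeff_mul_pow {z : A⟦X⟧} (hz : constantCoeff z = 0)
    (hz1 : IsUnit (coeff 1 z)) {a b : A⟦X⟧}
    (h : ∀ l ≤ k, coeff k (a * z ^ l) = coeff k (b * z ^ l)) : jet A k a = jet A k b := by
  rw [Ideal.Quotient.eq, Ideal.mem_span_singleton]
  have key : ∀ m ≤ k + 1, (X : A⟦X⟧) ^ m ∣ a - b := by
    intro m
    induction m with
    | zero => simp
    | succ m ih =>
      intro hm
      obtain ⟨d, hd⟩ := ih (by omega)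
      have h1 := coeff_mul_pow_eq hz d m (k - m)
      rw [← hd, show m + (k - m) = k by omega, sub_mul, map_sub, h _ (by omega), sub_self] at h1
      have h2 : constantCoeff d = 0 := ((hz1.pow _).mul_left_eq_zero).1 h1.symm
      rw [hd, pow_succ]
      exact mul_dvd_mul_left _ (X_dvd_iff.2 h2)
  exact key _ le_rfl

end Jet

/-! ### The state |E_k⟩ as the top coefficient of a product -/

section Tensor

variable {n k : ℕ}

theorem coeff_prod_eq_sum_stateE (r : Fin n → ℂ⟦X⟧) :
    coeff k (∏ j, r j) =
      ∑ i : Fin n → Fin (k + 1), (∏ j, coeff (i j : ℕ) (r j)) * stateE n k k i := by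
  simp only [stateE, mul_ite, mul_one, mul_zero]
  rw [← Finset.sum_filter, coeff_prod]
  symm
  refine Finset.sum_bij' (fun i _ => Finsupp.equivFunOnFinite.symm fun j => (i j : ℕ))
    (fun f hf j => ⟨f j, ?_⟩) ?_ ?_ ?_ ?_ ?_
  · rw [Finset.mem_finsuppAntidiag] at hf
    have h1 : f j ≤ ∑ j, f j :=
      Finset.single_le_sum (f := fun j => f j) (fun _ _ => Nat.zero_le _) (Finset.mem_univ j)
    have h2 : ∑ j, f j = k := hf.1
    omega
  all_goals simp [Finset.mem_finsuppAntidiag]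

theorem tensorOp_mulVec_stateE {S : Fin n → Matrix (Fin (k + 1)) (Fin (k + 1)) ℂ}
    {r : Fin n → Fin (k + 1) → ℂ⟦X⟧} (h : ∀ j m l, S j m l = coeff (l : ℕ) (r j m))
    (m : Fin n → Fin (k + 1)) :
    (tensorOp S *ᵥ stateE n k k) m = coeff k (∏ j, r j (m j)) := by
  rw [coeff_prod_eq_sum_stateE]
  simp [Matrix.mulVec, dotProduct, tensorOp, h]

theorem tensorOp_substMatrix (u : Fin n → ℂ⟦X⟧) (z : ℂ⟦X⟧) (m : Fin n → Fin (k + 1)) :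
    (tensorOp (fun j => substMatrix k (u j) z) *ᵥ stateE n k k) m =
      coeff k ((∏ j, u j) * z ^ ∑ j, (m j : ℕ)) := by
  rw [tensorOp_mulVec_stateE (S := fun j => substMatrix k (u j) z)
      (r := fun j m => u j * z ^ (m : ℕ)) (fun _ _ _ => rfl),
    Finset.prod_mul_distrib, Finset.prod_pow_eq_pow_sum]

/-- The labels of total degree `l ≤ k` exist as soon as there is a party. -/
theorem exists_sum_eq (hn : 0 < n) {l : ℕ} (hl : l ≤ k) :
    ∃ m : Fin n → Fin (k + 1), ∑ j, (m j : ℕ) = l := by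
  refine ⟨Pi.single ⟨0, hn⟩ ⟨l, by omega⟩, ?_⟩
  rw [Finset.sum_eq_single ⟨0, hn⟩]
  · simp
  · intro j _ hj
    simp [hj]
  · simp

/-- The component at a label depends only on its total degree l, and for l > k it vanishes because
z^l has order above k. -/
theorem tensorOp_substMatrix_eq_smul_iff (hn : 0 < n) (u : Fin n → ℂ⟦X⟧) {z : ℂ⟦X⟧}
    (hz : constantCoeff z = 0) (μ : ℂ) :
    tensorOp (fun j => substMatrix k (u j) z) *ᵥ stateE n k k = μ • stateE n k k ↔
      ∀ l ≤ k, coeff k ((∏ j, u j) * z ^ l) = if l = k then μ else 0 := by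
  constructor
  · intro h l hl
    obtain ⟨m, rfl⟩ := exists_sum_eq (n := n) hn hl
    rw [← tensorOp_substMatrix, h]
    simp [stateE]
  · intro h
    ext m
    rw [tensorOp_substMatrix]
    rcases le_or_gt (∑ j, (m j : ℕ)) k with hm | hm
    · rw [h _ hm]
      simp [stateE]
    · have := coeff_mul_pow_eq_zero hz (∏ j, u j) (i := 0) (l := ∑ j, (m j : ℕ)) (m := k) (by omega)
      simp only [pow_zero, one_mul] at this
      simp [this, stateE, hm.ne']

end Tensor

/-- Maps `L j` of a commutative ring that preserve, up to a scalar, the value `φ` of the product of at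
least three factors are multiples of one multiplicative map, provided that `φ` is nondegenerate. -/
theorem exists_monoidHom_of_preserves_prod {R : Type*} [CommRing R] {φ : R → ℂ}
    (hφ : ∀ a b, (∀ r, φ (a * r) = φ (b * r)) → a = b) {n : ℕ} (hn : 3 ≤ n) {L : Fin n → R → R}
    (hL : ∀ j, Function.Surjective (L j)) {μ : ℂ}
    (h : ∀ f : Fin n → R, φ (∏ j, L j (f j)) = μ * φ (∏ j, f j)) :
    ∃ (σ : R →* R) (u : Fin n → Rˣ), ∀ j f, L j f = u j * σ f := by
  -- A third party m carries a preimage of the test element r and all further parties carry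
  -- preimages of 1. The product of the arguments does not depend on which of i, j carries b.
  have shift : ∀ i j : Fin n, i ≠ j → ∀ b f g, L i (b * f) * L j g = L i f * L j (b * g) := by
    intro i j hij b f g
    refine hφ _ _ fun r => ?_
    obtain ⟨m, hmi, hmj⟩ : ∃ m : Fin n, m ≠ i ∧ m ≠ j := by
      have hc : ({i, j} : Finset (Fin n)).card < (Finset.univ : Finset (Fin n)).card := by
        have := Finset.card_le_two (a := i) (b := j)
        rw [Finset.card_univ, Fintype.card_fin]
        omega
      obtain ⟨m, -, hm⟩ := Finset.exists_mem_notMem_of_card_lt_card hc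
      exact ⟨m, by simpa using hm⟩
    obtain ⟨p, hp⟩ := hL m r
    choose o ho using fun l => hL l 1
    let F : R → R → Fin n → R := fun x y l =>
      if l = i then x else if l = j then y else if l = m then p else o l
    have prodL : ∀ x y, ∏ l, L l (F x y l) = L i x * L j y * r := by
      intro x y
      have : ∀ l, L l (F x y l) = (if l = i then L i x else 1) * (if l = j then L j y else 1) *
          (if l = m then r else 1) := by
        intro l
        simp only [F]
        by_cases h1 : l = i
        · subst h1; simp [hij, hmi.symm]
        · by_cases h2 : l = j
          · subst h2; simp [h1, hmj.symm]
          · by_cases h3 : l = m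
            · subst h3; simp [h1, h2, hp]
            · simp [h1, h2, h3, ho]
      simp only [this, Finset.prod_mul_distrib, Finset.prod_ite_eq', Finset.mem_univ, if_true]
    have prodF : ∏ l, F (b * f) g l = ∏ l, F f (b * g) l := by
      have h1 : ∀ l, F (b * f) g l = (if l = i then b else 1) * F f g l := by
        intro l
        by_cases h1 : l = i <;> simp [F, h1]
      have h2 : ∀ l, F f (b * g) l = (if l = j then b else 1) * F f g l := by
        intro l
        by_cases h2 : l = j
        · subst h2; simp [F, hij.symm]
        · simp [F, h2]
      simp only [h1, h2, Finset.prod_mul_distrib, Finset.prod_ite_eq', Finset.mem_univ, if_true]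
    rw [← prodL, ← prodL, h, h, prodF]
  have cross : ∀ i j, i ≠ j → ∀ b g, L i b * L j g = L i 1 * L j (b * g) := by
    intro i j hij b g
    simpa using shift i j hij b 1 g
  have other : ∀ i : Fin n, ∃ j, i ≠ j := by
    intro i
    have : Nontrivial (Fin n) := Fin.nontrivial_iff_two_le.2 (by omega)
    obtain ⟨j, hj⟩ := exists_ne i
    exact ⟨j, hj.symm⟩
  -- With L i b = 1 and L j g = 1, `cross` reads 1 = L i 1 * L j (b * g).
  have hu : ∀ i, IsUnit (L i 1) := by
    intro i
    obtain ⟨j, hij⟩ := other i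
    obtain ⟨b, hb⟩ := hL i 1
    obtain ⟨g, hg⟩ := hL j 1
    have := cross i j hij b g
    rw [hb, hg, mul_one] at this
    exact IsUnit.of_mul_eq_one _ this.symm
  choose u hu' using hu
  let i₀ : Fin n := ⟨0, by omega⟩
  have same : ∀ j f, (↑(u j)⁻¹ : R) * L j f = ↑(u i₀)⁻¹ * L i₀ f := by
    intro j f
    rcases eq_or_ne j i₀ with rfl | hj
    · rfl
    · have := cross j i₀ hj f 1
      rw [mul_one, ← hu', ← hu'] at this
      rw [Units.inv_mul_eq_iff_eq_mul, mul_left_comm, ← this, mul_left_comm, Units.inv_mul, mul_one]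
  refine ⟨⟨⟨fun f => ↑(u i₀)⁻¹ * L i₀ f, ?_⟩, ?_⟩, u, ?_⟩
  · rw [← hu', Units.inv_mul]
  · intro b g
    obtain ⟨j, hj⟩ := other i₀
    have := cross i₀ j hj b g
    simp only
    rw [← same j g, ← same j (b * g), mul_mul_mul_comm, this, ← hu']
    calc _ = (↑(u i₀)⁻¹ * ↑(u i₀)) * (↑(u j)⁻¹ * L j (b * g)) := by rw [Units.inv_mul, one_mul]
      _ = _ := by ring
  · intro j f
    change L j f = u j * (↑(u i₀)⁻¹ * L i₀ f)
    rw [← same j f, Units.mul_inv_cancel_left]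

/-! ### Rigidity: local symmetries are weighted substitutions with a common z -/

section

variable {n k : ℕ}

/-- The power series whose first coefficients are the entries of `v`. -/
noncomputable def rowSeries (v : Fin (k + 1) → ℂ) : ℂ⟦X⟧ :=
  mk fun l => if h : l < k + 1 then v ⟨l, h⟩ else 0

@[simp]
theorem coeff_rowSeries (v : Fin (k + 1) → ℂ) (l : Fin (k + 1)) :
    coeff (l : ℕ) (rowSeries v) = v l := by
  rw [rowSeries, coeff_mk, dif_pos l.2]

theorem jet_rowSeries (f : ℂ⟦X⟧) :
    jet ℂ k (rowSeries fun m : Fin (k + 1) => coeff (m : ℕ) f) = jet ℂ k f := by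
  rw [jet_eq_iff]
  intro i hi
  exact coeff_rowSeries (fun m : Fin (k + 1) => coeff (m : ℕ) f) ⟨i, Nat.lt_succ_iff.2 hi⟩

theorem coeff_prod_rowSeries_vecMul (S : Fin n → Matrix (Fin (k + 1)) (Fin (k + 1)) ℂ)
    (c : Fin n → Fin (k + 1) → ℂ) :
    coeff k (∏ j, rowSeries (c j ᵥ* S j)) =
      (fun m => ∏ j, c j (m j)) ⬝ᵥ (tensorOp S *ᵥ stateE n k k) := by
  rw [coeff_prod_eq_sum_stateE, Matrix.dotProduct_mulVec]
  refine Finset.sum_congr rfl fun i _ => ?_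
  congr 1
  simp only [coeff_rowSeries, Matrix.vecMul, dotProduct, tensorOp, Matrix.of_apply,
    ← Finset.prod_mul_distrib]
  rw [Finset.prod_univ_sum, Fintype.piFinset_univ]

theorem exists_substMatrix_of_mulVec_eq_smul (hn : 3 ≤ n)
    {S : Fin n → Matrix (Fin (k + 1)) (Fin (k + 1)) ℂ} (hS : ∀ j, IsUnit (S j)) {μ : ℂ}
    (h : tensorOp S *ᵥ stateE n k k = μ • stateE n k k) :
    ∃ (z : ℂ⟦X⟧) (u : Fin n → ℂ⟦X⟧), constantCoeff z = 0 ∧ coeff 1 z ≠ 0 ∧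
      (∀ j, constantCoeff (u j) ≠ 0) ∧ ∀ j, S j = substMatrix k (u j) z := by
  let q := jet ℂ k
  have q_surj : Function.Surjective q := Ideal.Quotient.mk_surjective
  obtain ⟨out, hout⟩ := q_surj.hasRightInverse
  have coeff_out : ∀ a : ℂ⟦X⟧, ∀ i ≤ k, coeff i (out (q a)) = coeff i a := fun a i hi =>
    coeff_eq_of_jet_eq (hout (q a)) hi
  let c : ℂ⟦X⟧ → Fin (k + 1) → ℂ := fun f m => coeff (m : ℕ) f
  -- The action of S j on row vectors, carried over to the quotient ring; `hLq` shows that the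
  -- choice of representative is immaterial.
  let L : Fin n → _ → _ := fun j r => q (rowSeries (c (out r) ᵥ* S j))
  have hLq : ∀ j f, L j (q f) = q (rowSeries (c f ᵥ* S j)) := by
    intro j f
    have : c (out (q f)) = c f := by
      ext m
      exact coeff_out f m (Nat.lt_succ_iff.1 m.2)
    simp only [L, this]
  have hφ : ∀ a b, (∀ r, coeff k (out (a * r)) = coeff k (out (b * r))) → a = b := by
    intro a b hab
    obtain ⟨a, rfl⟩ := q_surj a
    obtain ⟨b, rfl⟩ := q_surj b
    refine jet_eq_of_coeff_mul_pow (z := X) (by simp) (by simp) fun l _ => ?_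
    have := hab (q (X ^ l))
    rwa [← map_mul, ← map_mul, coeff_out _ _ le_rfl, coeff_out _ _ le_rfl] at this
  have hL : ∀ j, Function.Surjective (L j) := by
    intro j r
    obtain ⟨f, rfl⟩ := q_surj r
    refine ⟨q (rowSeries (c f ᵥ* (S j)⁻¹)), ?_⟩
    rw [hLq]
    have : c (rowSeries (c f ᵥ* (S j)⁻¹)) = c f ᵥ* (S j)⁻¹ := by
      ext m
      exact coeff_rowSeries _ _
    rw [this, Matrix.vecMul_vecMul, Matrix.nonsing_inv_mul _ ((Matrix.isUnit_iff_isUnit_det _).1 (hS j)),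
      Matrix.vecMul_one]
    exact jet_rowSeries f
  have hprod : ∀ f : Fin n → _, coeff k (out (∏ j, L j (f j))) = μ * coeff k (out (∏ j, f j)) := by
    intro f
    choose g hg using fun j => q_surj (f j)
    obtain rfl : (fun j => q (g j)) = f := funext hg
    simp only [hLq]
    rw [← map_prod, ← map_prod, coeff_out _ _ le_rfl, coeff_out _ _ le_rfl,
      coeff_prod_rowSeries_vecMul, h, dotProduct_smul, coeff_prod_eq_sum_stateE]
    rfl
  obtain ⟨σ, u, hσ⟩ := exists_monoidHom_of_preserves_prod (φ := fun r => coeff k (out r)) hφ hn hL hprod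
  obtain ⟨z, hz⟩ := q_surj (σ (q X))
  choose w hw using fun j => q_surj (u j : _)
  have hrow : ∀ j, S j = substMatrix k (w j) z := by
    intro j
    ext m l
    have h1 : L j (q (X ^ (m : ℕ))) = q (w j * z ^ (m : ℕ)) := by
      rw [hσ, map_pow, map_pow, map_mul, map_pow, hz, hw]
    have h2 : c (X ^ (m : ℕ)) = Pi.single m 1 := by
      ext i
      simp [c, coeff_X_pow, Pi.single_apply, Fin.ext_iff]
    rw [hLq, h2, Matrix.single_one_vecMul] at h1
    rw [substMatrix_apply, ← coeff_eq_of_jet_eq h1 (Nat.lt_succ_iff.1 l.2), coeff_rowSeries]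
    rfl
  have hw0 : ∀ j, constantCoeff (w j) ≠ 0 := by
    intro j
    obtain ⟨v, hv⟩ := q_surj (↑(u j)⁻¹ : _)
    have h1 : q (w j * v) = q 1 := by rw [map_mul, hw, hv, Units.mul_inv, map_one]
    have h2 := coeff_eq_of_jet_eq h1 (Nat.zero_le k)
    simp only [coeff_zero_eq_constantCoeff, map_mul, map_one] at h2
    exact left_ne_zero_of_mul_eq_one h2
  rcases Nat.eq_zero_or_pos k with rfl | hk
  -- For k = 0 only z^0 occurs, so z may be replaced by X.
  · refine ⟨X, w, by simp, by simp, hw0, fun j => ?_⟩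
    rw [hrow j]
    ext m l
    simp [substMatrix_apply]
  · let i₀ : Fin n := ⟨0, by omega⟩
    -- X is nilpotent in the quotient, hence so is its image z.
    have hz0 : constantCoeff z = 0 := by
      have hX : q (X ^ (k + 1)) = 0 := by
        rw [Ideal.Quotient.eq_zero_iff_mem]
        exact Ideal.mem_span_singleton_self _
      have h1 : u i₀ * q (z ^ (k + 1)) = q 0 := by
        rw [map_pow, hz, ← map_pow, ← map_pow, hX, ← hσ, ← map_zero q, hLq]
        congr 1
        ext i
        simp [c, rowSeries, Matrix.vecMul, dotProduct]
      rw [← hw i₀, ← map_mul] at h1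
      have h2 := coeff_eq_of_jet_eq h1 (Nat.zero_le k)
      simpa [hw0] using h2
    -- If X^2 divides z, the last row w z^k has order at least 2k > k and vanishes, contradicting
    -- invertibility.
    refine ⟨z, w, hz0, fun hz1 => ?_, hw0, hrow⟩
    have h1 : (S i₀).row (Fin.last k) = 0 := by
      ext l
      rw [hrow]
      obtain ⟨d, hd⟩ : (X : ℂ⟦X⟧) ^ 2 ∣ z := by
        rw [X_pow_dvd_iff]
        intro m hm
        interval_cases m
        · simpa using hz0
        · exact hz1
      have h2 : (X : ℂ⟦X⟧) ^ (2 * k) ∣ w i₀ * z ^ k := by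
        rw [hd, mul_pow, ← pow_mul]
        exact ⟨w i₀ * d ^ k, by ring⟩
      exact X_pow_dvd_iff.1 h2 l (by have := l.2; omega)
    have h2 : (S i₀).det = 0 := Matrix.det_eq_zero_of_row_eq_zero (Fin.last k) fun l => congrFun h1 l
    exact ((Matrix.isUnit_iff_isUnit_det _).1 (hS i₀)).ne_zero h2

end

/-! ### The triangular system for the weight u -/

section Weight

variable {A : Type*} [CommRing A] {k n : ℕ}

theorem coeff_add_pow_mul_pow_of_lt {z : A⟦X⟧} (hz : constantCoeff z = 0) (u d : A⟦X⟧) {m l : ℕ}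
    (h : k < m + l) : coeff k ((u + X ^ m * d) ^ n * z ^ l) = coeff k (u ^ n * z ^ l) := by
  obtain ⟨g, hg⟩ : X ^ m * d ∣ (u + X ^ m * d) ^ n - u ^ n := by
    have h1 := sub_dvd_pow_sub_pow (u + X ^ m * d) u n
    rwa [add_sub_cancel_left u (X ^ m * d)] at h1
  rw [← sub_eq_zero, ← map_sub, ← sub_mul, hg, mul_assoc (X ^ m)]
  exact coeff_mul_pow_eq_zero hz _ h

/-- The difference of the n-th powers is X^(m+1) d times a sum of n products with constant term 1,
which yields the factor n. -/
theorem coeff_add_pow_mul_pow_of_eq {z : A⟦X⟧} (hz : constantCoeff z = 0) (hz1 : coeff 1 z = 1)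
    {u : A⟦X⟧} (hu : constantCoeff u = 1) (d : A⟦X⟧) {m l : ℕ} (h : m + 1 + l = k) :
    coeff k ((u + X ^ (m + 1) * d) ^ n * z ^ l) =
      coeff k (u ^ n * z ^ l) + n * constantCoeff d := by
  have hg := (Commute.all (u + X ^ (m + 1) * d) u).geom_sum₂_mul n
  rw [add_sub_cancel_left] at hg
  rw [← sub_eq_iff_eq_add', ← map_sub, ← sub_mul, ← hg, mul_comm (Finset.sum _ _),
    mul_assoc (X ^ (m + 1)), ← h, coeff_mul_pow_eq hz, hz1]
  simp [hu, mul_comm]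

/-- The equations are solved from l = k - 1 downwards, each by correcting coefficient k - l of u,
which leaves the earlier ones intact. A general ring is allowed so that the parameters of z can be
indeterminates. -/
theorem exists_weight (hn : IsUnit (n : A)) {z : A⟦X⟧} (hz : constantCoeff z = 0)
    (hz1 : 0 < k → coeff 1 z = 1) :
    ∃ u : A⟦X⟧, constantCoeff u = 1 ∧ ∀ l < k, coeff k (u ^ n * z ^ l) = 0 := by
  have key : ∀ m ≤ k, ∃ u : A⟦X⟧, constantCoeff u = 1 ∧
      ∀ l < k, k ≤ l + m → coeff k (u ^ n * z ^ l) = 0 := by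
    intro m
    induction m with
    | zero => exact fun _ => ⟨1, by simp, fun l hl hl' => by omega⟩
    | succ m ih =>
      intro hm
      obtain ⟨u, hu, h⟩ := ih (by omega)
      obtain ⟨ν, hν⟩ := hn.exists_right_inv
      refine ⟨u + X ^ (m + 1) * C (-ν * coeff k (u ^ n * z ^ (k - (m + 1)))), by simp [hu], ?_⟩
      intro l hl hl'
      rcases Nat.lt_or_ge k (m + 1 + l) with h1 | h1
      · rw [coeff_add_pow_mul_pow_of_lt hz _ _ h1]
        exact h l hl (by omega)
      · obtain rfl : l = k - (m + 1) := by omega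
        rw [coeff_add_pow_mul_pow_of_eq hz (hz1 (by omega)) hu _ (by omega), constantCoeff_C,
          neg_mul, mul_neg, ← mul_assoc, hν, one_mul, add_neg_cancel]
  obtain ⟨u, hu, h⟩ := key k le_rfl
  exact ⟨u, hu, fun l hl => h l hl (by omega)⟩

theorem jet_weight_unique (hn : IsUnit (n : A)) {z : A⟦X⟧} (hz : constantCoeff z = 0)
    (hz1 : 0 < k → coeff 1 z = 1) {u v : A⟦X⟧} (hu : constantCoeff u = 1)
    (hv : constantCoeff v = 1) (h : ∀ l < k, coeff k (u ^ n * z ^ l) = 0)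
    (h' : ∀ l < k, coeff k (v ^ n * z ^ l) = 0) : jet A k u = jet A k v := by
  rw [Ideal.Quotient.eq, Ideal.mem_span_singleton]
  have key : ∀ m ≤ k, (X : A⟦X⟧) ^ (m + 1) ∣ u - v := by
    intro m
    induction m with
    | zero => simp [X_dvd_iff, hu, hv]
    | succ m ih =>
      intro hm
      obtain ⟨d, hd⟩ := ih (by omega)
      have h1 := coeff_add_pow_mul_pow_of_eq (n := n) hz (hz1 (by omega)) hv d
        (show m + 1 + (k - (m + 1)) = k by omega)
      rw [← hd, add_sub_cancel, h _ (by omega), h' _ (by omega), zero_add] at h1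
      rw [hd, pow_succ]
      exact mul_dvd_mul_left _ (X_dvd_iff.2 ((hn.mul_right_eq_zero).1 h1.symm))
  exact key k le_rfl

/-- The polynomial `y_1 X + ⋯ + y_k X ^ k` as a power series. -/
noncomputable def paramSeries (y : Fin k → A) : A⟦X⟧ :=
  ∑ j : Fin k, C (y j) * X ^ ((j : ℕ) + 1)

@[simp]
theorem constantCoeff_paramSeries (y : Fin k → A) : constantCoeff (paramSeries y) = 0 := by
  simp [paramSeries]

@[simp]
theorem coeff_succ_paramSeries (y : Fin k → A) (j : Fin k) :
    coeff ((j : ℕ) + 1) (paramSeries y) = y j := by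
  simp [paramSeries, coeff_X_pow, ← Fin.ext_iff]

theorem coeff_one_paramSeries (y : Fin k → A) (h : 0 < k) :
    coeff 1 (paramSeries y) = y ⟨0, h⟩ :=
  coeff_succ_paramSeries y ⟨0, h⟩

theorem map_paramSeries {B : Type*} [CommRing B] (f : A →+* B) (y : Fin k → A) :
    PowerSeries.map f (paramSeries y) = paramSeries fun j => f (y j) := by
  simp [paramSeries]

theorem paramSeries_smul (x : A) (y : Fin k → A) : paramSeries (x • y) = C x * paramSeries y := by
  simp [paramSeries, Finset.mul_sum, mul_assoc]

theorem paramSeries_injective {y y' : Fin k → A}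
    (h : jet A k (paramSeries y) = jet A k (paramSeries y')) : y = y' := by
  ext j
  simpa using coeff_eq_of_jet_eq h (i := (j : ℕ) + 1) (by omega)

theorem map_substMatrix {B : Type*} [CommRing B] (f : A →+* B) (u z : A⟦X⟧) :
    (substMatrix k u z).map f = substMatrix k (PowerSeries.map f u) (PowerSeries.map f z) := by
  ext m l
  simp only [Matrix.map_apply, substMatrix_apply, ← coeff_map, map_mul, map_pow]

end Weight

/-! ### The matrices S̄ -/

section Sbar

variable {k n : ℕ}

/-- The recursion says that row i + 1, as a power series, is row i times y_1 X + ⋯ + y_k X^k. -/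
theorem recursion_substMatrix (u : ℂ⟦X⟧) (y : Fin k → ℂ) :
    Recursion y (substMatrix k u (paramSeries y)) := by
  intro i l
  have h : u * paramSeries y ^ ((i : ℕ) + 1) =
      ∑ j : Fin k, C (y j) * (u * paramSeries y ^ (i : ℕ) * X ^ ((j : ℕ) + 1)) := by
    rw [pow_succ, ← mul_assoc]
    conv_lhs => rw [paramSeries, Finset.mul_sum, ← paramSeries]
    exact Finset.sum_congr rfl fun _ _ => by ring
  rw [substMatrix_apply, Fin.val_succ, h, map_sum]
  refine Finset.sum_congr rfl fun j _ => ?_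
  rw [coeff_C_mul, coeff_mul_X_pow', substMatrix_apply, mul_comm]
  simp only [Fin.val_castSucc]
  by_cases h1 : (i : ℕ) + ((j : ℕ) + 1) ≤ (l : ℕ)
  · rw [if_pos h1, if_pos (by omega)]
  · rw [if_neg h1]
    -- These terms lie outside the range of the recursion; they vanish because row i has order at
    -- least i.
    split_ifs with h2
    · have := coeff_mul_pow_eq_zero (constantCoeff_paramSeries y) u (i := 0) (l := (i : ℕ))
        (m := (l : ℕ) - ((j : ℕ) + 1)) (by omega)
      rw [pow_zero, one_mul] at this
      rw [this, zero_mul]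
    · rw [zero_mul]

theorem Recursion.ext {y : Fin k → ℂ} {S T : Matrix (Fin (k + 1)) (Fin (k + 1)) ℂ}
    (hS : Recursion y S) (hT : Recursion y T) (h : S 0 = T 0) : S = T := by
  funext i
  induction i using Fin.induction with
  | zero => exact h
  | succ i ih =>
    funext l
    rw [hS, hT, ih]

theorem Recursion.eq_substMatrix {y : Fin k → ℂ} {S : Matrix (Fin (k + 1)) (Fin (k + 1)) ℂ}
    (hS : Recursion y S) : S = substMatrix k (rowSeries (S 0)) (paramSeries y) := by
  refine hS.ext (recursion_substMatrix _ _) ?_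
  ext l
  simp [substMatrix_apply]

theorem isUnitUpper_substMatrix_iff {u : ℂ⟦X⟧} {y : Fin k → ℂ} :
    IsUnitUpper (substMatrix k u (paramSeries y)) ↔
      constantCoeff u = 1 ∧ ∀ h : 0 < k, y ⟨0, h⟩ = 1 := by
  have hz := constantCoeff_paramSeries y
  constructor
  · rintro ⟨-, h⟩
    have h0 : constantCoeff u = 1 := by
      have := h 0
      rw [substMatrix_diag hz] at this
      simpa using this
    refine ⟨h0, fun hk => ?_⟩
    have := h ⟨1, by omega⟩
    rw [substMatrix_diag hz, h0, coeff_one_paramSeries y hk] at this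
    simpa using this
  · rintro ⟨h0, h1⟩
    refine ⟨substMatrix_blockTriangular hz, fun l => ?_⟩
    rw [substMatrix_diag hz, h0, one_mul]
    rcases Nat.eq_zero_or_pos k with rfl | hk
    · simp
    · rw [coeff_one_paramSeries y hk, h1 hk, one_pow]

theorem overlapsVanish_substMatrix_iff (hn : 0 < n) {u z : ℂ⟦X⟧} :
    OverlapsVanish n (substMatrix k u z) ↔ ∀ l < k, coeff k (u ^ n * z ^ l) = 0 := by
  refine forall₂_congr fun l hl => ?_
  have h : star (stateE n k l) ⬝ᵥ (tensorOp (fun _ : Fin n => substMatrix k u z) *ᵥ stateE n k k) =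
      ((Finset.univ.filter fun m : Fin n → Fin (k + 1) => ∑ j, (m j : ℕ) = l).card : ℂ) *
        coeff k (u ^ n * z ^ l) := by
    simp only [dotProduct, tensorOp_substMatrix, Pi.star_apply, stateE, apply_ite (star : ℂ → ℂ),
      star_one, star_zero, ite_mul, one_mul, zero_mul]
    rw [← Finset.sum_filter, ← nsmul_eq_mul, ← Finset.sum_const]
    refine Finset.sum_congr rfl fun m hm => ?_
    rw [(Finset.mem_filter.1 hm).2]
    simp
  rw [h, mul_eq_zero, or_iff_right]
  obtain ⟨m, hm⟩ := exists_sum_eq (n := n) hn hl.le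
  rw [Nat.cast_eq_zero]
  exact (Finset.card_pos.2 ⟨m, by simpa using hm⟩).ne'

theorem isSbar_substMatrix_iff (hn : 0 < n) {u : ℂ⟦X⟧} {y : Fin k → ℂ} :
    IsSbar n y (substMatrix k u (paramSeries y)) ↔
      constantCoeff u = 1 ∧ (∀ h : 0 < k, y ⟨0, h⟩ = 1) ∧
        ∀ l < k, coeff k (u ^ n * paramSeries y ^ l) = 0 := by
  rw [IsSbar, isUnitUpper_substMatrix_iff, overlapsVanish_substMatrix_iff hn, and_assoc]
  simp only [recursion_substMatrix, true_and]

theorem IsSbar.exists_eq_substMatrix (hn : 0 < n) {y : Fin k → ℂ}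
    {S : Matrix (Fin (k + 1)) (Fin (k + 1)) ℂ} (h : IsSbar n y S) :
    ∃ u : ℂ⟦X⟧, S = substMatrix k u (paramSeries y) ∧ constantCoeff u = 1 ∧
      (∀ h : 0 < k, y ⟨0, h⟩ = 1) ∧ ∀ l < k, coeff k (u ^ n * paramSeries y ^ l) = 0 := by
  have h1 := h.2.1.eq_substMatrix
  refine ⟨_, h1, ?_⟩
  rw [h1] at h
  exact (isSbar_substMatrix_iff hn).1 h

theorem recursion_param_unique {y y' : Fin k → ℂ} {S : Matrix (Fin (k + 1)) (Fin (k + 1)) ℂ}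
    (h : Recursion y S) (h' : Recursion y' S) (h0 : S 0 0 ≠ 0) : y = y' := by
  refine paramSeries_injective (jet_eq_of_substMatrix_eq'
    (h.eq_substMatrix.symm.trans h'.eq_substMatrix) ?_ (by simp) (by simp))
  rw [← coeff_zero_eq_constantCoeff_apply]
  have := coeff_rowSeries (S 0) 0
  rw [Fin.val_zero] at this
  rw [this]
  exact h0.isUnit

/-- The weight is found once over the polynomial ring and then specialised at y; uniqueness over ℂ
shows that nothing else occurs. -/
theorem exists_matrix_isSbar_iff (hn : 0 < n) :
    ∃ P : Matrix (Fin (k + 1)) (Fin (k + 1)) (MvPolynomial (Fin k) ℂ),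
      ∀ (y : Fin k → ℂ) (S : Matrix (Fin (k + 1)) (Fin (k + 1)) ℂ),
        IsSbar n y S ↔ (∀ h : 0 < k, y ⟨0, h⟩ = 1) ∧ S = P.map (MvPolynomial.eval y) := by
  have hu : IsUnit (n : ℂ) := by simpa using hn.ne'
  -- The leading coefficient must be 1 for the system to be solvable by division by n alone, so y_1
  -- is replaced by 1.
  let p : Fin k → MvPolynomial (Fin k) ℂ := fun j => if (j : ℕ) = 0 then 1 else MvPolynomial.X j
  obtain ⟨u, hu0, hu1⟩ := exists_weight (k := k) (n := n) (z := paramSeries p)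
    (by simpa using hu.map (MvPolynomial.C (σ := Fin k))) (by simp)
    (fun h => by rw [coeff_one_paramSeries _ h]; simp [p])
  have hmap : ∀ y : Fin k → ℂ, (∀ h : 0 < k, y ⟨0, h⟩ = 1) →
      PowerSeries.map (MvPolynomial.eval y) (paramSeries p) = paramSeries y := by
    intro y hy
    rw [map_paramSeries]
    congr 1
    ext j
    by_cases hj : (j : ℕ) = 0
    · have h : j = ⟨0, j.pos⟩ := Fin.ext hj
      rw [h, hy]
      simp [p]
    · simp [p, hj]
  have hw : ∀ y : Fin k → ℂ, constantCoeff (PowerSeries.map (MvPolynomial.eval y) u) = 1 := by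
    intro y
    rw [← coeff_zero_eq_constantCoeff_apply, coeff_map, coeff_zero_eq_constantCoeff_apply, hu0,
      map_one]
  have hv : ∀ y : Fin k → ℂ, (∀ h : 0 < k, y ⟨0, h⟩ = 1) → ∀ l < k,
      coeff k (PowerSeries.map (MvPolynomial.eval y) u ^ n * paramSeries y ^ l) = 0 := by
    intro y hy l hl
    rw [← hmap y hy, ← map_pow, ← map_pow, ← map_mul, coeff_map, hu1 l hl, map_zero]
  refine ⟨substMatrix k u (paramSeries p), fun y S => ⟨fun h => ?_, ?_⟩⟩
  · obtain ⟨v, rfl, hv0, hy, hv1⟩ := h.exists_eq_substMatrix hn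
    refine ⟨hy, ?_⟩
    rw [map_substMatrix, hmap y hy]
    exact substMatrix_congr (jet_weight_unique hu (by simp)
      (fun h => by rw [coeff_one_paramSeries _ h, hy h]) hv0 (hw y) hv1 (hv y hy)) rfl
  · rintro ⟨hy, rfl⟩
    rw [map_substMatrix, hmap y hy]
    exact (isSbar_substMatrix_iff hn).2 ⟨hw y, hy, hv y hy⟩

theorem sum_onesState (hk : 0 < k) {t : ℕ} (ht : t ≤ n) : ∑ j, (onesState n k t j : ℕ) = t := by
  have h : ∀ j, (onesState n k t j : ℕ) = if (j : ℕ) < t then 1 else 0 := by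
    intro j
    unfold onesState
    split_ifs
    · rw [Fin.val_one', Nat.mod_eq_of_lt (by omega)]
    · rfl
  simp only [h]
  rw [Fin.sum_univ_eq_sum_range (fun j => if j < t then 1 else 0), ← Finset.sum_filter]
  simp only [Finset.sum_const, smul_eq_mul, mul_one]
  rw [show (Finset.range n).filter (· < t) = Finset.range t by
    ext j; simp only [Finset.mem_filter, Finset.mem_range]; omega, Finset.card_range]

/-- All components of one total degree agree, so a single label tests each overlap. The labels need
up to k - 1 parties in |1⟩, whence k ≤ n + 1. -/
theorem exists_linear_equations (hn : 0 < n) (hk : k ≤ n + 1) :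
    ∃ Q : (l : Fin k) → MvPolynomial (Fin k ⊕ Fin ((l : ℕ) + 1)) ℂ,
      ∀ (y : Fin k → ℂ) (S : Matrix (Fin (k + 1)) (Fin (k + 1)) ℂ),
        IsUnitUpper S → Recursion y S →
        (∀ l : Fin k,
          (tensorOp (fun _ : Fin n => S) *ᵥ stateE n k k)
              (onesState n k (k - ((l : ℕ) + 1))) =
            (n : ℂ) * S 0 l.succ +
              MvPolynomial.eval
                (Sum.elim y fun p : Fin ((l : ℕ) + 1) => S 0 ⟨(p : ℕ), by omega⟩) (Q l)) ∧
        (OverlapsVanish n S ↔ ∀ l : Fin k,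
          (tensorOp (fun _ : Fin n => S) *ᵥ stateE n k k)
              (onesState n k (k - ((l : ℕ) + 1))) = 0) := by
  -- Q is the same coefficient with row 0 truncated after degree l; the omitted coefficient l + 1
  -- contributes exactly n S_{0,l+1}.
  refine ⟨fun l => coeff k ((∑ p : Fin ((l : ℕ) + 1), C (MvPolynomial.X (Sum.inr p)) * X ^ (p : ℕ)) ^ n
    * paramSeries (fun j => MvPolynomial.X (Sum.inl j)) ^ (k - ((l : ℕ) + 1))), ?_⟩
  intro y S hS hR
  have hSu := hR.eq_substMatrix
  set u := rowSeries (S 0) with hu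
  have hcoeff : ∀ l : Fin (k + 1), coeff (l : ℕ) u = S 0 l := fun l => coeff_rowSeries (S 0) l
  rw [hSu, isUnitUpper_substMatrix_iff] at hS
  have hones : ∀ l : Fin k, (tensorOp (fun _ : Fin n => S) *ᵥ stateE n k k)
      (onesState n k (k - ((l : ℕ) + 1))) = coeff k (u ^ n * paramSeries y ^ (k - ((l : ℕ) + 1))) := by
    intro l
    conv_lhs => rw [hSu]
    rw [tensorOp_substMatrix, sum_onesState l.pos (by omega)]
    simp
  simp only [hones]
  constructor
  · intro l
    set t : ℂ⟦X⟧ := ∑ p : Fin ((l : ℕ) + 1), C (S 0 ⟨(p : ℕ), by omega⟩) * X ^ (p : ℕ) with ht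
    have ht_coeff : ∀ i < (l : ℕ) + 1, coeff i t = coeff i u := by
      intro i hi
      have := hcoeff ⟨i, by omega⟩
      simp only at this
      rw [this, ht, map_sum, Finset.sum_eq_single ⟨i, hi⟩]
      · simp
      · intro p _ hp
        have : i ≠ (p : ℕ) := fun h => hp (Fin.ext h.symm)
        simp [coeff_X_pow, this]
      · simp
    obtain ⟨d, hd⟩ : (X : ℂ⟦X⟧) ^ ((l : ℕ) + 1) ∣ u - t := by
      rw [X_pow_dvd_iff]
      intro m hm
      rw [map_sub, ht_coeff m hm, sub_self]
    have hd0 : constantCoeff d = S 0 l.succ := by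
      have h1 : coeff ((l : ℕ) + 1) t = 0 := by
        rw [ht, map_sum]
        refine Finset.sum_eq_zero fun p _ => ?_
        have : (l : ℕ) + 1 ≠ p := by omega
        simp [coeff_X_pow, this]
      have h2 := congrArg (coeff ((l : ℕ) + 1)) hd
      have h3 := coeff_X_pow_mul d ((l : ℕ) + 1) 0
      rw [zero_add] at h3
      rw [map_sub, h1, sub_zero, h3] at h2
      have h4 := hcoeff l.succ
      rw [Fin.val_succ, h2] at h4
      simpa using h4
    have ht0 : constantCoeff t = 1 := by
      rw [← coeff_zero_eq_constantCoeff_apply, ht_coeff 0 (by omega),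
        coeff_zero_eq_constantCoeff_apply, hS.1]
    have hut : u = t + X ^ ((l : ℕ) + 1) * d := by rw [← hd]; ring
    conv_lhs => rw [hut]
    rw [coeff_add_pow_mul_pow_of_eq (by simp)
      (by rw [coeff_one_paramSeries _ l.pos, hS.2 l.pos]) ht0 _ (by omega), hd0, add_comm]
    congr 1
    rw [← coeff_map]
    refine congrArg (coeff k) ?_
    rw [map_mul, map_pow, map_pow, map_paramSeries, map_sum]
    simp [ht]
  · conv_lhs => rw [hSu]
    rw [overlapsVanish_substMatrix_iff hn]
    constructor
    · exact fun h l => h _ (by have := l.2; omega)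
    · intro h l hl
      have := h ⟨k - 1 - l, by omega⟩
      simp only at this
      rwa [show k - (k - 1 - l + 1) = l by omega] at this

end Sbar

/-! ### Symmetries of |E_k⟩ and generation of the stabilizer -/

section Symmetries

variable {k n : ℕ}

theorem diagPow_mul_substMatrix (x : ℂ) (u z : ℂ⟦X⟧) :
    diagPow k x * substMatrix k u z = substMatrix k u (C x * z) := by
  ext m l
  have h : u * (C x * z) ^ (m : ℕ) = C (x ^ (m : ℕ)) * (u * z ^ (m : ℕ)) := by
    rw [map_pow]; ring
  rw [diagPow, Matrix.diagonal_mul, substMatrix_apply, substMatrix_apply, h, coeff_C_mul]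

theorem smul_diagPow_mul_substMatrix (c x : ℂ) (u z : ℂ⟦X⟧) :
    c • (diagPow k x * substMatrix k u z) = substMatrix k (C c * u) (C x * z) := by
  rw [diagPow_mul_substMatrix, smul_substMatrix, smul_eq_C_mul]

theorem jet_eq_C_mul_paramSeries {z : ℂ⟦X⟧} (hz : constantCoeff z = 0) (hz1 : coeff 1 z ≠ 0) :
    jet ℂ k z = jet ℂ k (C (coeff 1 z) *
      paramSeries fun j : Fin k => (coeff 1 z)⁻¹ * coeff ((j : ℕ) + 1) z) := by
  rw [jet_eq_iff]
  intro i hi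
  rw [coeff_C_mul]
  rcases i with _ | i
  · simp [hz]
  · have := coeff_succ_paramSeries
      (fun j : Fin k => (coeff 1 z)⁻¹ * coeff ((j : ℕ) + 1) z) ⟨i, by omega⟩
    simp only at this
    rw [this, mul_inv_cancel_left₀ hz1]

theorem coeff_scaled (c x : ℂ) (u z : ℂ⟦X⟧) (l : ℕ) :
    coeff k ((C c * u) ^ n * (C x * z) ^ l) = c ^ n * x ^ l * coeff k (u ^ n * z ^ l) := by
  have h : (C c * u) ^ n * (C x * z) ^ l = C (c ^ n * x ^ l) * (u ^ n * z ^ l) := by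
    rw [map_mul, map_pow, map_pow]; ring
  rw [h, coeff_C_mul]

theorem coeff_scaled_weight {c x : ℂ} {u : ℂ⟦X⟧} {y : Fin k → ℂ} (hu : constantCoeff u = 1)
    (hy : ∀ h : 0 < k, y ⟨0, h⟩ = 1) (h : ∀ l < k, coeff k (u ^ n * paramSeries y ^ l) = 0)
    {l : ℕ} (hl : l ≤ k) :
    coeff k ((C c * u) ^ n * (C x * paramSeries y) ^ l) = if l = k then c ^ n * x ^ k else 0 := by
  rw [coeff_scaled]
  split_ifs with hlk
  · have h1 := coeff_mul_pow_eq (constantCoeff_paramSeries y) (u ^ n) 0 k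
    rw [pow_zero, one_mul, zero_add] at h1
    rw [hlk, h1, map_pow, hu, one_pow, one_mul]
    rcases Nat.eq_zero_or_pos k with rfl | hk
    · simp
    · rw [coeff_one_paramSeries y hk, hy hk, one_pow, mul_one]
  · rw [h l (by omega), mul_zero]

/-- By rigidity A has a weight u and a substitution z. Dividing out c = u(0) and x = z'(0)
normalises them to those of some S̄, and the equation l = k gives μ. -/
theorem mulVec_stateE_eq_smul_iff (hn : 3 ≤ n) (A : Matrix.GeneralLinearGroup (Fin (k + 1)) ℂ)
    (μ : ℂ) :
    tensorOp (fun _ : Fin n => (A : Matrix (Fin (k + 1)) (Fin (k + 1)) ℂ)) *ᵥ stateE n k k =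
        μ • stateE n k k ↔
      ∃ (c x : ℂ) (y : Fin k → ℂ) (S : Matrix (Fin (k + 1)) (Fin (k + 1)) ℂ),
        x ≠ 0 ∧ IsSbar n y S ∧ μ = c ^ n * x ^ k ∧
        (A : Matrix (Fin (k + 1)) (Fin (k + 1)) ℂ) = c • (diagPow k x * S) := by
  constructor
  · intro h
    obtain ⟨z, w, hz, hz1, hw, hA⟩ :=
      exists_substMatrix_of_mulVec_eq_smul hn (fun _ => A.isUnit) h
    have hA := hA ⟨0, by omega⟩
    have hw := hw ⟨0, by omega⟩
    set u := w ⟨0, by omega⟩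
    set x := coeff 1 z
    set c := constantCoeff u
    let y : Fin k → ℂ := fun j => x⁻¹ * coeff ((j : ℕ) + 1) z
    have hjz : jet ℂ k z = jet ℂ k (C x * paramSeries y) := jet_eq_C_mul_paramSeries hz hz1
    have hu : u = C c * (C c⁻¹ * u) := by
      rw [← mul_assoc, ← map_mul, mul_inv_cancel₀ hw, map_one, one_mul]
    rw [hA, tensorOp_substMatrix_eq_smul_iff (by omega) (fun _ => u) hz] at h
    simp only [Finset.prod_const, Finset.card_univ, Fintype.card_fin] at h
    have hμ : μ = c ^ n * x ^ k := by
      have h1 := coeff_mul_pow_eq hz (u ^ n) 0 k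
      rw [pow_zero, one_mul, zero_add, h k le_rfl, if_pos rfl, map_pow] at h1
      exact h1
    refine ⟨c, x, y, substMatrix k (C c⁻¹ * u) (paramSeries y), hz1,
      (isSbar_substMatrix_iff (by omega)).2 ⟨?_, ?_, ?_⟩, hμ, ?_⟩
    · rw [map_mul, constantCoeff_C]
      exact inv_mul_cancel₀ hw
    · exact fun hk => inv_mul_cancel₀ hz1
    · intro l hl
      have h1 : jet ℂ k (u ^ n * z ^ l) =
          jet ℂ k ((C c * (C c⁻¹ * u)) ^ n * (C x * paramSeries y) ^ l) := by
        rw [← hu, map_mul, map_mul, map_pow _ z, hjz, map_pow _ (C x * _)]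
      have h2 := coeff_eq_of_jet_eq h1 le_rfl
      rw [coeff_scaled, h l hl.le, if_neg hl.ne] at h2
      exact (mul_eq_zero.1 h2.symm).resolve_left
        (mul_ne_zero (pow_ne_zero _ hw) (pow_ne_zero _ hz1))
    · rw [smul_diagPow_mul_substMatrix, ← hu, hA]
      exact substMatrix_congr rfl hjz
  · rintro ⟨c, x, y, S, -, hS, rfl, hA⟩
    obtain ⟨u, rfl, hu, hy, hu'⟩ := hS.exists_eq_substMatrix (by omega)
    rw [hA, smul_diagPow_mul_substMatrix,
      tensorOp_substMatrix_eq_smul_iff (by omega) (fun _ => C c * u) (by simp)]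
    intro l hl
    simp only [Finset.prod_const, Finset.card_univ, Fintype.card_fin]
    exact coeff_scaled_weight hu hy hu' hl

theorem isUpperToeplitz_iff {B : Matrix (Fin (k + 1)) (Fin (k + 1)) ℂ} :
    IsUpperToeplitz B ↔ ∃ v : ℂ⟦X⟧, B = substMatrix k v X := by
  constructor
  · rintro ⟨b, hb⟩
    refine ⟨mk b, ?_⟩
    ext i j
    rw [hb, substMatrix_apply, coeff_mul_X_pow', coeff_mk]
    rfl
  · rintro ⟨v, rfl⟩
    refine ⟨fun i => coeff i v, fun i j => ?_⟩
    rw [substMatrix_apply, coeff_mul_X_pow']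
    rfl

/-- The Toeplitz matrix of multiplication by a power series modulo `X ^ (k + 1)`. -/
noncomputable def toeplitzHom (k : ℕ) : ℂ⟦X⟧ →* Matrix (Fin (k + 1)) (Fin (k + 1)) ℂ where
  toFun v := substMatrix k v X
  map_one' := substMatrix_one_X
  map_mul' u v := (substMatrix_mul_X u X v).symm

/-- The Toeplitz matrix of an invertible power series, as an invertible matrix. -/
noncomputable def toeplitzUnits (k : ℕ) :
    ℂ⟦X⟧ˣ →* Matrix.GeneralLinearGroup (Fin (k + 1)) ℂ :=
  Units.map (toeplitzHom k)

theorem coe_toeplitzUnits (v : ℂ⟦X⟧ˣ) :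
    (toeplitzUnits k v : Matrix (Fin (k + 1)) (Fin (k + 1)) ℂ) = substMatrix k v X :=
  rfl

theorem isUpperToeplitz_coe_iff {B : Matrix.GeneralLinearGroup (Fin (k + 1)) ℂ} :
    IsUpperToeplitz (B : Matrix (Fin (k + 1)) (Fin (k + 1)) ℂ) ↔ ∃ v, B = toeplitzUnits k v := by
  rw [isUpperToeplitz_iff]
  constructor
  · rintro ⟨v, hv⟩
    have hdet : (B : Matrix (Fin (k + 1)) (Fin (k + 1)) ℂ).det ≠ 0 :=
      ((Matrix.isUnit_iff_isUnit_det _).1 B.isUnit).ne_zero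
    have h0 : constantCoeff v ≠ 0 := by
      rw [hv, Matrix.det_of_isUpperTriangular (substMatrix_blockTriangular (by simp)),
        Finset.prod_ne_zero_iff] at hdet
      have := hdet 0 (Finset.mem_univ _)
      rw [substMatrix_diag (by simp)] at this
      exact left_ne_zero_of_mul this
    exact ⟨(isUnit_iff_constantCoeff.2 h0.isUnit).unit, Units.ext hv⟩
  · rintro ⟨v, rfl⟩
    exact ⟨v, rfl⟩

theorem pairOp_toeplitzUnits (i j : Fin n) (v : ℂ⟦X⟧ˣ) :
    pairOp i j (toeplitzUnits k v) =
      (toeplitzUnits k).compLeft (Fin n) (Pi.mulSingle i v * Pi.mulSingle j v⁻¹) := by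
  funext l
  simp only [pairOp, Pi.mul_apply, MonoidHom.compLeft_apply, Function.comp_apply, map_mul,
    Pi.mulSingle_apply, apply_ite (toeplitzUnits k), map_one, map_inv]

theorem mem_stabilizer_of_prod_eq_one {v : Fin n → ℂ⟦X⟧ˣ} (hn : 0 < n) (hv : ∏ j, v j = 1) :
    (toeplitzUnits k).compLeft (Fin n) v ∈ stabilizer (stateE n k k) := by
  change tensorOp (fun j => substMatrix k (v j : ℂ⟦X⟧) X) *ᵥ stateE n k k = stateE n k k
  have h := (tensorOp_substMatrix_eq_smul_iff (k := k) hn (fun j => (v j : ℂ⟦X⟧)) (z := X)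
    (by simp) 1).2
  rw [one_smul] at h
  refine h fun l _ => ?_
  rw [← Units.coe_prod, hv, Units.val_one, one_mul, coeff_X_pow]
  simp only [eq_comm]

theorem exists_eq_substMatrix_of_mem_stabilizer (hn : 3 ≤ n)
    {S : Fin n → Matrix.GeneralLinearGroup (Fin (k + 1)) ℂ}
    (h : S ∈ stabilizer (stateE n k k)) :
    ∃ (z : ℂ⟦X⟧) (u : Fin n → ℂ⟦X⟧), constantCoeff z = 0 ∧ coeff 1 z ≠ 0 ∧
      (∀ j, constantCoeff (u j) ≠ 0) ∧ (∀ j, (S j : Matrix _ _ ℂ) = substMatrix k (u j) z) ∧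
      ∀ l ≤ k, coeff k ((∏ j, u j) * z ^ l) = if l = k then 1 else 0 := by
  have h' : tensorOp (fun j => (S j : Matrix _ _ ℂ)) *ᵥ stateE n k k = (1 : ℂ) • stateE n k k := by
    rw [one_smul]; exact h
  obtain ⟨z, u, hz, hz1, hu, hS⟩ := exists_substMatrix_of_mulVec_eq_smul hn (fun j => (S j).isUnit) h'
  refine ⟨z, u, hz, hz1, hu, hS, ?_⟩
  rw [← tensorOp_substMatrix_eq_smul_iff (by omega) u hz, ← h']
  simp only [hS]

theorem pairOp_mem_stabilizer_iff (hn : 3 ≤ n) {i j : Fin n} (hij : i ≠ j)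
    (B : Matrix.GeneralLinearGroup (Fin (k + 1)) ℂ) :
    pairOp i j B ∈ stabilizer (stateE n k k) ↔
      IsUpperToeplitz (B : Matrix (Fin (k + 1)) (Fin (k + 1)) ℂ) := by
  constructor
  · intro h
    obtain ⟨z, u, hz, -, hu, hS, -⟩ := exists_eq_substMatrix_of_mem_stabilizer hn h
    -- The identity acts on a third party m, and this forces the common z to be X modulo X^(k+1).
    obtain ⟨m, hm⟩ : ∃ m : Fin n, m ∉ ({i, j} : Finset (Fin n)) := by
      by_contra! hc
      have h1 := Finset.card_le_card (fun m _ => hc m : Finset.univ ⊆ ({i, j} : Finset (Fin n)))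
      have h2 := Finset.card_le_two (a := i) (b := j)
      rw [Finset.card_univ, Fintype.card_fin] at h1
      omega
    simp only [Finset.mem_insert, Finset.mem_singleton, not_or] at hm
    have hm' := hS m
    simp only [pairOp, Pi.mul_apply, Pi.mulSingle_eq_of_ne hm.1, Pi.mulSingle_eq_of_ne hm.2,
      mul_one, Units.val_one] at hm'
    rw [← substMatrix_one_X] at hm'
    have hzX := jet_eq_of_substMatrix_eq' hm'.symm (hu m).isUnit hz (by simp)
    have hi := hS i
    simp only [pairOp, Pi.mul_apply, Pi.mulSingle_eq_same, Pi.mulSingle_eq_of_ne hij, mul_one] at hi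
    exact isUpperToeplitz_iff.2 ⟨u i, hi.trans (substMatrix_congr rfl hzX)⟩
  · intro h
    obtain ⟨v, rfl⟩ := isUpperToeplitz_coe_iff.1 h
    rw [pairOp_toeplitzUnits]
    refine mem_stabilizer_of_prod_eq_one (by omega) ?_
    simp only [Pi.mul_apply, Finset.prod_mul_distrib, Finset.prod_pi_mulSingle', Finset.mem_univ,
      if_true, mul_inv_cancel]

/-- Toeplitz matrices commute, so pair operators move every factor to party 0, where the total
product acts trivially. -/
theorem compLeft_toeplitzUnits_mem_closure (hn : 0 < n) {v : Fin n → ℂ⟦X⟧ˣ}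
    (hv : toeplitzUnits k (∏ j, v j) = 1) :
    (toeplitzUnits k).compLeft (Fin n) v ∈ Subgroup.closure (pairGenerators n k) := by
  let i₀ : Fin n := ⟨0, hn⟩
  have hdecomp : v = (∏ j, (Pi.mulSingle j (v j) * Pi.mulSingle i₀ (v j)⁻¹)) *
      Pi.mulSingle i₀ (∏ j, v j) := by
    have h1 : ∏ j, (Pi.mulSingle i₀ (v j)⁻¹ : Fin n → ℂ⟦X⟧ˣ) = Pi.mulSingle i₀ (∏ j, (v j)⁻¹) :=
      (map_prod (MonoidHom.mulSingle (fun _ : Fin n => ℂ⟦X⟧ˣ) i₀) _ _).symm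
    rw [Finset.prod_mul_distrib, Finset.univ_prod_mulSingle, h1, mul_assoc, ← Pi.mulSingle_mul,
      Finset.prod_inv_distrib, inv_mul_cancel, Pi.mulSingle_one, mul_one]
  have hlast : (toeplitzUnits k).compLeft (Fin n) (Pi.mulSingle i₀ (∏ j, v j)) = 1 := by
    funext l
    simp only [MonoidHom.compLeft_apply, Function.comp_apply, Pi.mulSingle_apply,
      apply_ite (toeplitzUnits k), hv, map_one, ite_self, Pi.one_apply]
  rw [hdecomp, map_mul, hlast, mul_one, ← Subgroup.mem_comap]
  refine Subgroup.prod_mem _ fun j _ => ?_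
  rw [Subgroup.mem_comap, ← pairOp_toeplitzUnits]
  rcases eq_or_ne j i₀ with h | h
  · rw [h, pairOp, ← Pi.mulSingle_mul, mul_inv_cancel, Pi.mulSingle_one]
    exact one_mem _
  · exact Subgroup.subset_closure ⟨j, i₀, h, _, isUpperToeplitz_coe_iff.2 ⟨_, rfl⟩, rfl⟩

theorem stabilizer_eq_closure (hn : 3 ≤ n) :
    stabilizer (stateE n k k) =
      Subgroup.closure (pairGenerators n k ∪ powerGenerators n k) := by
  apply le_antisymm
  · intro S hS
    obtain ⟨z, u, hz, hz1, hu, hSu, hprod⟩ := exists_eq_substMatrix_of_mem_stabilizer hn hS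
    set x := coeff 1 z with hx
    let y : Fin k → ℂ := fun j => x⁻¹ * coeff ((j : ℕ) + 1) z
    have hjz : jet ℂ k z = jet ℂ k (C x * paramSeries y) := jet_eq_C_mul_paramSeries hz hz1
    have hy : ∀ h : 0 < k, y ⟨0, h⟩ = 1 := fun _ => inv_mul_cancel₀ hz1
    obtain ⟨w, hw0, hw⟩ := exists_weight (k := k) (n := n) (A := ℂ) (z := paramSeries y)
      (by simp; omega) (by simp) (fun h => by rw [coeff_one_paramSeries _ h, hy h])
    obtain ⟨c, hc⟩ := IsAlgClosed.exists_pow_nat_eq (x ^ k)⁻¹ (show 0 < n by omega)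
    have hcx : c ^ n * x ^ k = 1 := by rw [hc, inv_mul_cancel₀ (pow_ne_zero _ hz1)]
    have hc0 : c ≠ 0 := by
      rintro rfl
      rw [zero_pow (by omega), zero_mul] at hcx
      exact zero_ne_one hcx
    have hW : IsUnit (C c * w) := by
      rw [isUnit_iff_constantCoeff]
      simp [hw0, hc0]
    obtain ⟨W, hW⟩ := hW
    have hU : ∀ j, IsUnit (u j) := fun j => isUnit_iff_constantCoeff.2 (hu j).isUnit
    choose U hU using hU
    let v : Fin n → ℂ⟦X⟧ˣ := fun j => U j * W⁻¹
    -- Both sides have the same top coefficient against every z^l with l ≤ k.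
    have hjW : jet ℂ k (∏ j, u j) = jet ℂ k ((C c * w) ^ n) := by
      refine jet_eq_of_coeff_mul_pow hz hz1.isUnit fun l hl => ?_
      have h1 : jet ℂ k ((C c * w) ^ n * z ^ l) =
          jet ℂ k ((C c * w) ^ n * (C x * paramSeries y) ^ l) := by
        rw [map_mul, map_mul _ ((C c * w) ^ n), map_pow _ z, hjz, map_pow _ (C x * _)]
      rw [hprod l hl, coeff_eq_of_jet_eq h1 le_rfl, coeff_scaled_weight hw0 hy hw hl, hcx]
    have hv : toeplitzUnits k (∏ j, v j) = 1 := by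
      have h1 : ((∏ j, v j : ℂ⟦X⟧ˣ) : ℂ⟦X⟧) = (∏ j, u j) * ((W ^ n)⁻¹ : ℂ⟦X⟧ˣ) := by
        simp only [v, Finset.prod_mul_distrib, Finset.prod_const, Finset.card_univ,
          Fintype.card_fin, Units.val_mul, Units.coe_prod, hU, inv_pow]
      apply Units.ext
      rw [coe_toeplitzUnits, Units.val_one, ← substMatrix_one_X]
      refine substMatrix_congr ?_ rfl
      rw [h1, map_mul, hjW, ← hW, ← map_mul, ← Units.val_pow_eq_pow_val, Units.mul_inv]
    let i₀ : Fin n := ⟨0, by omega⟩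
    -- Stripping v_j from S_j leaves weight c w and substitution z, the same for every party.
    let A := S i₀ * (toeplitzUnits k (v i₀))⁻¹
    have hA : (A : Matrix _ _ ℂ) = substMatrix k (C c * w) z := by
      simp only [A]
      rw [← map_inv, Units.val_mul, coe_toeplitzUnits, hSu, substMatrix_mul_X, ← hW, ← hU]
      simp only [v, mul_inv_rev, inv_inv, Units.val_mul]
      rw [mul_left_comm, Units.mul_inv, mul_one]
    have hSA : S = (fun _ => A) * (toeplitzUnits k).compLeft (Fin n) v := by
      funext j
      apply Units.ext
      rw [Pi.mul_apply, Units.val_mul, hA]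
      change _ = _ * substMatrix k (v j : ℂ⟦X⟧) X
      rw [substMatrix_mul_X, hSu, ← hW, ← hU]
      simp only [v, Units.val_mul]
      rw [mul_left_comm, Units.mul_inv, mul_one]
    rw [hSA]
    refine mul_mem (Subgroup.subset_closure (Or.inr ?_))
      (Subgroup.closure_mono Set.subset_union_left
        (compLeft_toeplitzUnits_mem_closure (by omega) hv))
    refine ⟨A, c, x, y, substMatrix k w (paramSeries y), hz1,
      (isSbar_substMatrix_iff (by omega)).2 ⟨hw0, hy, hw⟩, hcx, ?_, rfl⟩
    rw [hA, smul_diagPow_mul_substMatrix]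
    exact substMatrix_congr rfl hjz
  · rw [Subgroup.closure_le]
    rintro g (⟨i, j, hij, B, hB, rfl⟩ | ⟨A, c, x, y, T, hx, hT, hcx, hA, rfl⟩)
    · exact (pairOp_mem_stabilizer_iff hn hij B).2 hB
    · have := (mulVec_stateE_eq_smul_iff hn A 1).2 ⟨c, x, y, T, hx, hT, hcx.symm, hA⟩
      rw [one_smul] at this
      exact this

end Symmetries

/-! ### The groups formed by S̄ and by D_x S̄ -/

section Groups

variable {k n : ℕ}

theorem mul_apply_diag {d : ℕ} {A B : Matrix (Fin d) (Fin d) ℂ} (hA : A.BlockTriangular id)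
    (hB : B.BlockTriangular id) (l : Fin d) : (A * B) l l = A l l * B l l := by
  rw [Matrix.mul_apply]
  refine Finset.sum_eq_single l (fun j _ hj => ?_) (by simp)
  rcases lt_or_gt_of_ne hj with h | h
  · rw [hA h, zero_mul]
  · rw [hB h, mul_zero]

/-- The group of invertible upper triangular matrices whose `l`-th diagonal entry is `1`. -/
def upperFixing {d : ℕ} (l : Fin d) : Subgroup (Matrix.GeneralLinearGroup (Fin d) ℂ) where
  carrier := {A | (A : Matrix (Fin d) (Fin d) ℂ).BlockTriangular id ∧
    (A : Matrix (Fin d) (Fin d) ℂ) l l = 1}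
  one_mem' := ⟨Matrix.blockTriangular_one, by simp⟩
  mul_mem' := by
    rintro A B ⟨hA, hA'⟩ ⟨hB, hB'⟩
    refine ⟨hA.mul hB, ?_⟩
    rw [Units.val_mul, mul_apply_diag hA hB, hA', hB', one_mul]
  inv_mem' := by
    rintro A ⟨hA, hA'⟩
    have hinv : ((A⁻¹ : Matrix.GeneralLinearGroup (Fin d) ℂ) :
        Matrix (Fin d) (Fin d) ℂ).BlockTriangular id := by
      rw [Matrix.coe_units_inv]
      have := A.invertible
      exact Matrix.blockTriangular_inv_of_blockTriangular hA
    refine ⟨hinv, ?_⟩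
    have h := mul_apply_diag hA hinv l
    rwa [← Units.val_mul, mul_inv_cancel, Units.val_one, Matrix.one_apply_eq, hA', one_mul,
      eq_comm] at h

/-- The group of all invertible `A` such that `A^{⊗ n}` has `ψ` as an eigenvector. -/
def eigenGroup {n d : ℕ} (ψ : (Fin n → Fin d) → ℂ) :
    Subgroup (Matrix.GeneralLinearGroup (Fin d) ℂ) where
  carrier := {A | ∃ μ : ℂ, tensorOp (fun _ => (A : Matrix (Fin d) (Fin d) ℂ)) *ᵥ ψ = μ • ψ}
  one_mem' := ⟨1, by
    have h := tensorOp_one (n := n) (d := d)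
    simp [h]⟩
  mul_mem' := by
    rintro A B ⟨μ, hA⟩ ⟨ν, hB⟩
    have h := tensorOp_mul (fun _ : Fin n => (A : Matrix (Fin d) (Fin d) ℂ))
      (fun _ => (B : Matrix (Fin d) (Fin d) ℂ))
    refine ⟨ν * μ, ?_⟩
    simp only [Units.val_mul]
    rw [h, ← Matrix.mulVec_mulVec, hB, Matrix.mulVec_smul, hA, smul_smul]
  inv_mem' := by
    rintro A ⟨μ, hA⟩
    have h := tensorOp_mul
      (fun _ : Fin n => ((A⁻¹ : Matrix.GeneralLinearGroup (Fin d) ℂ) : Matrix (Fin d) (Fin d) ℂ))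
      (fun _ => (A : Matrix (Fin d) (Fin d) ℂ))
    simp only [← Units.val_mul, inv_mul_cancel, Units.val_one] at h
    rw [tensorOp_one] at h
    have h1 : ψ = μ • (tensorOp (fun _ : Fin n => ((A⁻¹ : Matrix.GeneralLinearGroup (Fin d) ℂ) :
        Matrix (Fin d) (Fin d) ℂ)) *ᵥ ψ) := by
      rw [← Matrix.mulVec_smul, ← hA, Matrix.mulVec_mulVec, ← h, Matrix.one_mulVec]
    refine ⟨μ⁻¹, ?_⟩
    -- An eigenvalue 0 of an invertible operator means ψ = 0, and then any scalar will do.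
    rcases eq_or_ne μ 0 with rfl | hμ
    · rw [zero_smul] at h1
      simp [h1]
    · conv_rhs => rw [h1]
      rw [smul_smul, inv_mul_cancel₀ hμ, one_smul]

theorem IsUnitUpper.det_eq_one {d : ℕ} {S : Matrix (Fin d) (Fin d) ℂ} (h : IsUnitUpper S) :
    S.det = 1 := by
  rw [Matrix.det_of_isUpperTriangular h.1]
  exact Finset.prod_eq_one fun l _ => h.2 l

/-- The S̄ are the unit upper triangular A for which A^{⊗ n} fixes |E_k⟩, a description closed under
products and inverses. The diagonal entries c x^l = 1 force c = 1 and D_x = 1. -/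
theorem exists_subgroup_isSbar (hn : 3 ≤ n) :
    ∃ H : Subgroup (Matrix.GeneralLinearGroup (Fin (k + 1)) ℂ),
      ∀ S : Matrix (Fin (k + 1)) (Fin (k + 1)) ℂ,
        (∃ y : Fin k → ℂ, IsSbar n y S) ↔
          ∃ g ∈ H, (g : Matrix (Fin (k + 1)) (Fin (k + 1)) ℂ) = S := by
  refine ⟨(stabilizer (stateE n k k)).comap (Pi.constMonoidHom (Fin n) _) ⊓ ⨅ l, upperFixing l,
    fun S => ?_⟩
  simp only [Subgroup.mem_inf, Subgroup.mem_iInf, Subgroup.mem_comap]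
  constructor
  · rintro ⟨y, hS⟩
    have hu : IsUnit S := (Matrix.isUnit_iff_isUnit_det _).2 (by rw [hS.1.det_eq_one]; exact isUnit_one)
    obtain ⟨g, rfl⟩ := hu
    refine ⟨g, ⟨?_, fun l => ⟨hS.1.1, hS.1.2 l⟩⟩, rfl⟩
    have := (mulVec_stateE_eq_smul_iff hn g 1).2 ⟨1, 1, y, g, one_ne_zero, hS, by simp, by
      simp [diagPow]⟩
    rw [one_smul] at this
    exact this
  · rintro ⟨g, ⟨hg, hd⟩, rfl⟩
    obtain ⟨c, x, y, S, hx, hS, -, hgS⟩ := (mulVec_stateE_eq_smul_iff hn g 1).1 (by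
      rw [one_smul]; exact hg)
    have hdiag : ∀ l : Fin (k + 1), c * x ^ (l : ℕ) = 1 := by
      intro l
      have := (hd l).2
      rw [hgS] at this
      simpa [diagPow, Matrix.diagonal_mul, hS.1.2 l] using this
    have hc : c = 1 := by simpa using hdiag 0
    refine ⟨y, ?_⟩
    have h1 : diagPow k x = 1 := by
      rw [diagPow, ← Matrix.diagonal_one]
      congr 1
      funext l
      simpa [hc] using hdiag l
    rw [hgS, hc, h1, one_mul, one_smul]
    exact hS

/-- Here |E_k⟩ need only be an eigenvector; fixing the entry at (0, 0) to be 1 removes the scalar c.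
-/
theorem exists_subgroup_diagPow_mul (hn : 3 ≤ n) :
    ∃ G : Subgroup (Matrix.GeneralLinearGroup (Fin (k + 1)) ℂ),
      ∀ M : Matrix (Fin (k + 1)) (Fin (k + 1)) ℂ,
        (∃ (x : ℂ) (y : Fin k → ℂ) (S : Matrix (Fin (k + 1)) (Fin (k + 1)) ℂ),
            x ≠ 0 ∧ IsSbar n y S ∧ M = diagPow k x * S) ↔
          ∃ g ∈ G, (g : Matrix (Fin (k + 1)) (Fin (k + 1)) ℂ) = M := by
  refine ⟨eigenGroup (stateE n k k) ⊓ upperFixing 0, fun M => ?_⟩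
  simp only [Subgroup.mem_inf]
  constructor
  · rintro ⟨x, y, S, hx, hS, hM⟩
    have hu : IsUnit M := by
      rw [Matrix.isUnit_iff_isUnit_det, hM, Matrix.det_mul, hS.1.det_eq_one, mul_one, diagPow,
        Matrix.det_diagonal, isUnit_iff_ne_zero]
      exact Finset.prod_ne_zero_iff.2 fun l _ => pow_ne_zero _ hx
    obtain ⟨g, rfl⟩ := hu
    refine ⟨g, ⟨⟨_, (mulVec_stateE_eq_smul_iff hn g _).2
      ⟨1, x, y, S, hx, hS, rfl, by rw [hM, one_smul]⟩⟩, ?_, ?_⟩, rfl⟩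
    · rw [hM]
      exact (Matrix.blockTriangular_diagonal _).mul hS.1.1
    · simp [hM, diagPow, Matrix.diagonal_mul, hS.1.2 0]
  · rintro ⟨g, ⟨⟨μ, hg⟩, hd⟩, rfl⟩
    obtain ⟨c, x, y, S, hx, hS, -, hgS⟩ := (mulVec_stateE_eq_smul_iff hn g μ).1 hg
    have hc : c = 1 := by
      have := hd.2
      rw [hgS] at this
      simpa [diagPow, Matrix.diagonal_mul, hS.1.2 0] using this
    exact ⟨x, y, S, hx, hS, by rw [hgS, hc, one_smul]⟩

theorem IsSbar.recursion_diagPow_mul (hn : 0 < n) {x : ℂ} {y : Fin k → ℂ}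
    {S : Matrix (Fin (k + 1)) (Fin (k + 1)) ℂ} (hS : IsSbar n y S) :
    Recursion (x • y) (diagPow k x * S) := by
  obtain ⟨u, rfl, -⟩ := hS.exists_eq_substMatrix hn
  rw [diagPow_mul_substMatrix, ← paramSeries_smul]
  exact recursion_substMatrix u _

theorem IsSbar.param_eq_smul (hn : 0 < n) {x : ℂ} {y : Fin k → ℂ}
    {S : Matrix (Fin (k + 1)) (Fin (k + 1)) ℂ} (hS : IsSbar n y S) {z : Fin k → ℂ}
    (hz : Recursion z (diagPow k x * S)) : z = x • y := by
  refine recursion_param_unique hz (hS.recursion_diagPow_mul hn) ?_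
  simp [diagPow, Matrix.diagonal_mul, hS.1.2 0]

theorem exists_isSbar_param (hn : 0 < n) {z : Fin k → ℂ} (hz : ∀ h : 0 < k, z ⟨0, h⟩ ≠ 0) :
    ∃ (x : ℂ) (y : Fin k → ℂ) (S : Matrix (Fin (k + 1)) (Fin (k + 1)) ℂ),
      x ≠ 0 ∧ IsSbar n y S ∧ x • y = z := by
  obtain ⟨P, hP⟩ := exists_matrix_isSbar_iff (n := n) (k := k) hn
  obtain ⟨x, hx, hxz⟩ : ∃ x : ℂ, x ≠ 0 ∧ ∀ h : 0 < k, x = z ⟨0, h⟩ := by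
    by_cases hk : 0 < k
    · exact ⟨z ⟨0, hk⟩, hz hk, fun _ => rfl⟩
    · exact ⟨1, one_ne_zero, fun h => absurd h hk⟩
  refine ⟨x, x⁻¹ • z, _, hx, (hP _ _).2 ⟨fun h => ?_, rfl⟩, smul_inv_smul₀ hx z⟩
  rw [Pi.smul_apply, ← hxz h, smul_eq_mul, inv_mul_cancel₀ hx]

theorem diagPow_mul_unique (hn : 0 < n) {x x' : ℂ} {y y' : Fin k → ℂ}
    {S S' : Matrix (Fin (k + 1)) (Fin (k + 1)) ℂ} (hx : x ≠ 0) (hS : IsSbar n y S)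
    (hS' : IsSbar n y' S') (h : x • y = x' • y') : diagPow k x * S = diagPow k x' * S' := by
  obtain ⟨P, hP⟩ := exists_matrix_isSbar_iff (n := n) (k := k) hn
  have h1 := (hP _ _).1 hS
  have h2 := (hP _ _).1 hS'
  have hy : y = y' := by
    funext j
    have hk : 0 < k := j.pos
    have h3 := congrFun h ⟨0, hk⟩
    simp only [Pi.smul_apply, h1.1 hk, h2.1 hk, smul_eq_mul, mul_one] at h3
    rw [← h3] at h
    exact congrFun (smul_right_injective _ hx h) j
  have hR := hS.recursion_diagPow_mul hn (x := x)
  rw [h] at hR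
  -- D_x does not affect row 0, so x = x' is not needed; for k = 0 it could fail.
  refine hR.ext (hS'.recursion_diagPow_mul hn) ?_
  funext l
  simp [diagPow, Matrix.diagonal_mul, h1.2, h2.2, hy]

end Groups

end EState

theorem theorem6 (n k : ℕ) (hn : 3 ≤ n) :
    -- the two kinds of symmetries generate the stabilizer
    EState.stabilizer (EState.stateE n k k) =
      Subgroup.closure (EState.pairGenerators n k ∪ EState.powerGenerators n k) ∧
    -- all symmetries of the form `B ⊗ B⁻¹`
    (∀ i j : Fin n, i ≠ j → ∀ B : Matrix.GeneralLinearGroup (Fin (k + 1)) ℂ,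
      EState.pairOp i j B ∈ EState.stabilizer (EState.stateE n k k) ↔
        EState.IsUpperToeplitz (B : Matrix (Fin (k + 1)) (Fin (k + 1)) ℂ)) ∧
    -- all symmetries of the form `A^{⊗ n}`, with their proportionality factor
    (∀ (A : Matrix.GeneralLinearGroup (Fin (k + 1)) ℂ) (μ : ℂ),
      EState.tensorOp (fun _ : Fin n => (A : Matrix (Fin (k + 1)) (Fin (k + 1)) ℂ)) *ᵥ
          EState.stateE n k k = μ • EState.stateE n k k ↔
        ∃ (c x : ℂ) (y : Fin k → ℂ) (S : Matrix (Fin (k + 1)) (Fin (k + 1)) ℂ),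
          x ≠ 0 ∧ EState.IsSbar n y S ∧ μ = c ^ n * x ^ k ∧
          (A : Matrix (Fin (k + 1)) (Fin (k + 1)) ℂ) = c • (EState.diagPow k x * S)) ∧
    -- for `n ≥ k - 1`, the matrix `S̄` is found by successively solving equations that are linear in
    -- the unknown `S_{0,l+1}`, namely the projections onto `|1 … 1 0 … 0⟩` with `k - (l + 1)` ones
    (k ≤ n + 1 →
      ∃ Q : (l : Fin k) → MvPolynomial (Fin k ⊕ Fin ((l : ℕ) + 1)) ℂ,
        ∀ (y : Fin k → ℂ) (S : Matrix (Fin (k + 1)) (Fin (k + 1)) ℂ),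
          EState.IsUnitUpper S → EState.Recursion y S →
          (∀ l : Fin k,
            (EState.tensorOp (fun _ : Fin n => S) *ᵥ EState.stateE n k k)
                (EState.onesState n k (k - ((l : ℕ) + 1))) =
              (n : ℂ) * S 0 l.succ +
                MvPolynomial.eval
                  (Sum.elim y fun p : Fin ((l : ℕ) + 1) => S 0 ⟨(p : ℕ), by omega⟩) (Q l)) ∧
          (EState.OverlapsVanish n S ↔ ∀ l : Fin k,
            (EState.tensorOp (fun _ : Fin n => S) *ᵥ EState.stateE n k k)
                (EState.onesState n k (k - ((l : ℕ) + 1))) = 0)) ∧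
    -- `y_1 = 1` is forced, every choice of the remaining parameters leads to exactly one `S̄`, whose
    -- entries are polynomials in the parameters, and `S̄` determines its parameters
    (∃ P : Matrix (Fin (k + 1)) (Fin (k + 1)) (MvPolynomial (Fin k) ℂ),
      ∀ (y : Fin k → ℂ) (S : Matrix (Fin (k + 1)) (Fin (k + 1)) ℂ),
        EState.IsSbar n y S ↔
          (∀ h : 0 < k, y ⟨0, h⟩ = 1) ∧ S = P.map (MvPolynomial.eval y)) ∧
    (∀ (y y' : Fin k → ℂ) (S : Matrix (Fin (k + 1)) (Fin (k + 1)) ℂ),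
      EState.IsSbar n y S → EState.IsSbar n y' S → y = y') ∧
    -- the matrices `S̄` form a group
    (∃ H : Subgroup (Matrix.GeneralLinearGroup (Fin (k + 1)) ℂ),
      (∀ S : Matrix (Fin (k + 1)) (Fin (k + 1)) ℂ,
        (∃ y : Fin k → ℂ, EState.IsSbar n y S) ↔
          ∃ g ∈ H, (g : Matrix (Fin (k + 1)) (Fin (k + 1)) ℂ) = S)) ∧
    -- the matrices `D S̄` form a group with `k` parameters `z = x y`; every choice of `z` outside of
    -- the null set `z_1 = 0` leads to exactly one element
    (∃ G : Subgroup (Matrix.GeneralLinearGroup (Fin (k + 1)) ℂ),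
      (∀ M : Matrix (Fin (k + 1)) (Fin (k + 1)) ℂ,
        (∃ (x : ℂ) (y : Fin k → ℂ) (S : Matrix (Fin (k + 1)) (Fin (k + 1)) ℂ),
            x ≠ 0 ∧ EState.IsSbar n y S ∧ M = EState.diagPow k x * S) ↔
          ∃ g ∈ G, (g : Matrix (Fin (k + 1)) (Fin (k + 1)) ℂ) = M) ∧
      (∀ (x : ℂ) (y : Fin k → ℂ) (S : Matrix (Fin (k + 1)) (Fin (k + 1)) ℂ),
        x ≠ 0 → EState.IsSbar n y S →
          EState.Recursion (x • y) (EState.diagPow k x * S)) ∧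
      (∀ g ∈ G, ∃! z : Fin k → ℂ,
        EState.Recursion z (g : Matrix (Fin (k + 1)) (Fin (k + 1)) ℂ)) ∧
      (∀ z : Fin k → ℂ, (∀ h : 0 < k, z ⟨0, h⟩ ≠ 0) →
        ∃! g : Matrix.GeneralLinearGroup (Fin (k + 1)) ℂ,
          g ∈ G ∧ EState.Recursion z (g : Matrix (Fin (k + 1)) (Fin (k + 1)) ℂ)) ∧
      MeasureTheory.volume {z : Fin k → ℂ | ¬ ∃ g ∈ G,
        EState.Recursion z (g : Matrix (Fin (k + 1)) (Fin (k + 1)) ℂ)} = 0) := by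
  have hn0 : 0 < n := by omega
  refine ⟨EState.stabilizer_eq_closure hn,
    fun i j hij B => EState.pairOp_mem_stabilizer_iff hn hij B,
    fun A μ => EState.mulVec_stateE_eq_smul_iff hn A μ,
    EState.exists_linear_equations hn0,
    EState.exists_matrix_isSbar_iff hn0, fun y y' S hS hS' => ?_,
    EState.exists_subgroup_isSbar hn, ?_⟩
  · exact EState.recursion_param_unique hS.2.1 hS'.2.1 (by rw [hS.1.2 0]; exact one_ne_zero)
  obtain ⟨G, hG⟩ := EState.exists_subgroup_diagPow_mul (k := k) hn
  have hex : ∀ z : Fin k → ℂ, (∀ h : 0 < k, z ⟨0, h⟩ ≠ 0) →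
      ∃ g ∈ G, EState.Recursion z (g : Matrix (Fin (k + 1)) (Fin (k + 1)) ℂ) := by
    intro z hz
    obtain ⟨x, y, S, hx, hS, rfl⟩ := EState.exists_isSbar_param hn0 hz
    obtain ⟨g, hg, hgS⟩ := (hG _).1 ⟨x, y, S, hx, hS, rfl⟩
    exact ⟨g, hg, hgS ▸ hS.recursion_diagPow_mul hn0⟩
  refine ⟨G, hG, fun x y S _ hS => hS.recursion_diagPow_mul hn0, ?_, ?_, ?_⟩
  · intro g hg
    obtain ⟨x, y, S, -, hS, hgS⟩ := (hG _).2 ⟨g, hg, rfl⟩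
    rw [hgS]
    exact ⟨x • y, hS.recursion_diagPow_mul hn0, fun z hz => hS.param_eq_smul hn0 hz⟩
  · intro z hz
    obtain ⟨g, hg, hgz⟩ := hex z hz
    refine ⟨g, ⟨hg, hgz⟩, fun g' ⟨hg', hgz'⟩ => ?_⟩
    obtain ⟨x, y, S, -, hS, hgS⟩ := (hG _).2 ⟨g, hg, rfl⟩
    obtain ⟨x', y', S', hx', hS', hgS'⟩ := (hG _).2 ⟨g', hg', rfl⟩
    apply Units.ext
    rw [hgS] at hgz
    rw [hgS'] at hgz'
    rw [hgS, hgS']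
    exact EState.diagPow_mul_unique hn0 hx' hS' hS
      ((hS'.param_eq_smul hn0 hgz').symm.trans (hS.param_eq_smul hn0 hgz))
  -- The exceptional parameters lie in the hyperplane z_1 = 0; for k = 0 there are none.
  · by_cases hk : 0 < k
    · refine MeasureTheory.measure_mono_null (t := {z : Fin k → ℂ | z ⟨0, hk⟩ = 0}) ?_
        (MeasureTheory.Measure.pi_hyperplane _ _ _)
      intro z hz
      by_contra h
      exact hz (hex z fun _ => h)
    · refine MeasureTheory.measure_mono_null (t := ∅) ?_ MeasureTheory.measure_empty
      exact fun z hz => hz (hex z fun h => absurd h hk)
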